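/- \textbf{Proposition (existence of a minimal factorization).} Write $\mathbb T^2$ for the two-dimensional torus with its normalized Lebesgue measure and, for $g\in L^\infty(\mathbb T^2)$, $\operatorname{Spec}(g)=\{k\in\mathbb Z^2 : \hat g(k)\neq 0\}$. For linearly independent $e_1,e_2\in\mathbb R^2$ put $C^+[e_1,e_2]=\{ae_1+be_2 : a,b\ge 0\}$, $C^-[e_1,e_2]=-C^+[e_1,e_2]$ and $C[e_1,e_2]=C^+[e_1,e_2]\cup C^-[e_1,e_2]$. Let $\widetilde\Lambda\subset\mathbb R^2$ be a convex polygon with vertices $A_i\in\mathbb Z^2$ ($i\in\mathbb Z/m\mathbb Z$, $m\ge 3$), numbered cyclically along the boundary, no three of them collinear, and let $\Lambda=\widetilde\Lambda\cap\mathbb Z^2$. Let $\widetilde S_i^+$ be the closed half-plane that contains $\widetilde\Lambda$ and is bounded by the line $A_iA_{i+1}$, and let $\widetilde S_{i,0}^+=\widetilde S_i^+-A_i$ be its translate whose boundary passes through the origin. Put $S_i^+=\widetilde S_i^+\cap\mathbb Z^2$, $S_i^-=\mathbb Z^2\setminus S_i^+$ and $S_{i,0}^+=\widetilde S_{i,0}^+\cap\mathbb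 Z^2$. For a vertex $A=A_i$ put $C_{A,0}=C[A_{i-1}-A_i,\,A_{i+1}-A_i]$ and $C_{A,0}^+=C^+[A_{i-1}-A_i,\,A_{i+1}-A_i]$. Let $f:\mathbb T^2\to\mathbb R$ be everywhere strictly positive, essentially bounded and lower semicontinuous. Then for every vertex $A$ of the polygon there are a cone $C=C[e_1,e_2]\subset C_{A,0}$, with $C^+\subset C_{A,0}^+$, and a function $\alpha\in L^\infty(\mathbb T^2)$ such that $f=\alpha\bar\alpha$ almost everywhere and $\operatorname{Spec}(\alpha)\subset C^+$, for which the following hold. (1) For every $i\in\mathbb Z/m\mathbb Z$, either $C^+\subset\widetilde S_{i,0}^+$, and one sets $G_i=\alpha$, or $C^-\subset\widetilde S_{i,0}^+$, and one sets $G_i=\bar\alpha$; moreover $f=G_i\overline{G_i}$ almost everywhere, $G_i^{\pm1}\in L^\infty(\mathbb T^2)$ and $\operatorname{Spec}(G_i)\subset S_{i,0}^+$. (The tuple $(G_i)_i$ is the factorization of $f$ associated with $(\Lambda,A,C)$.) (2) This factorization reduces to the minimal factorization $(\alpha,\bar\alpha)$, with $p=2$: one has $\alpha\neq\bar\alpha$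 in $L^\infty(\mathbb T^2)$, and $\mathbb Z/m\mathbb Z$ is the disjoint union of two nonempty sets $I_1,I_2$, each consisting of cyclically consecutive indices, such that $G_i=\alpha$ for $i\in I_1$ and $G_i=\bar\alpha$ for $i\in I_2$. In particular $\operatorname{Spec}(\alpha)\subset\bigcap_{i\in I_1}S_{i,0}^+$ and $\operatorname{Spec}(\bar\alpha)\subset\bigcap_{i\in I_2}S_{i,0}^+$. (3) With $\mathbb S_j^-=\bigcup_{i\in I_j}S_i^-$ and $\mathbb S_j^+=\mathbb Z^2\setminus\mathbb S_j^-$ for $j=1,2$, one has $\Lambda=\mathbb S_1^+\cap\mathbb S_2^+$. -/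

import Mathlib

open scoped ENNReal
open MeasureTheory

/-! ### The torus, bounded functions and spectra -/

/-- The two-dimensional torus `𝕋²`, as `(ℝ/ℤ)²` through `x ↦ (e^{2πi x₀}, e^{2πi x₁})`. -/
abbrev Torus2 : Type := UnitAddTorus (Fin 2)

/-- Normalised Lebesgue (Haar) measure on `𝕋²`; the measure used by `UnitAddTorus.mFourierCoeff`. -/
noncomputable def torusMeasure : Measure Torus2 :=
  Measure.pi fun _ : Fin 2 => (AddCircle.haarAddCircle : Measure UnitAddCircle)

/-- The space `L^∞(𝕋²)` of complex essentially bounded functions, up to almost everywhere equality;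
`star` is complex conjugation. -/
abbrev Linfty : Type := Lp ℂ ∞ torusMeasure

/-- The point of `ℝ²` underlying a point of `ℤ²`. -/
def toPlane (k : Fin 2 → ℤ) : Fin 2 → ℝ := fun i => (k i : ℝ)

/-- The spectrum of `g`: the `k ∈ ℤ²` such that the `k`-th Fourier coefficient of `g` is nonzero. -/
def spec (g : Linfty) : Set (Fin 2 → ℤ) :=
  {k | UnitAddTorus.mFourierCoeff (g : Torus2 → ℂ) k ≠ 0}

/-- The points of `ℤ²` lying in a subset of the plane. -/
def trace (X : Set (Fin 2 → ℝ)) : Set (Fin 2 → ℤ) := {k | toPlane k ∈ X}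

/-! ### Cones with vertex at the origin -/

/-- The half-cone `C⁺[e₁, e₂] = {a e₁ + b e₂ : a, b ≥ 0}`. -/
def halfCone (e₁ e₂ : Fin 2 → ℝ) : Set (Fin 2 → ℝ) :=
  {x | ∃ a b : ℝ, 0 ≤ a ∧ 0 ≤ b ∧ x = a • e₁ + b • e₂}

/-- The opposite half-cone `C⁻[e₁, e₂] = {a e₁ + b e₂ : a, b ≤ 0}`. -/
def oppositeHalfCone (e₁ e₂ : Fin 2 → ℝ) : Set (Fin 2 → ℝ) :=
  {x | ∃ a b : ℝ, a ≤ 0 ∧ b ≤ 0 ∧ x = a • e₁ + b • e₂}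

/-- The (double) cone `C[e₁, e₂] = C⁺[e₁, e₂] ∪ C⁻[e₁, e₂]`. -/
def doubleCone (e₁ e₂ : Fin 2 → ℝ) : Set (Fin 2 → ℝ) :=
  halfCone e₁ e₂ ∪ oppositeHalfCone e₁ e₂

/-! ### Convex lattice polygons -/

/-- The determinant of two vectors of the plane. -/
def planeDet (x y : Fin 2 → ℝ) : ℝ := x 0 * y 1 - x 1 * y 0

/-- A convex polygon with `m ≥ 3` vertices in `ℤ²`, numbered cyclically along the boundary (in
either direction): for every side `[A i, A (i+1)]`, all the other vertices lie strictly on the same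
side of the line `A i A (i+1)`, namely the side of the vertex `A (i+2)`. -/
structure ConvexLatticePolygon (m : ℕ) where
  three_le : 3 ≤ m
  vertex : ZMod m → Fin 2 → ℤ
  convex : ∀ i j : ZMod m, j ≠ i → j ≠ i + 1 →
    0 < planeDet (toPlane (vertex (i + 1) - vertex i)) (toPlane (vertex j - vertex i)) *
      planeDet (toPlane (vertex (i + 1) - vertex i)) (toPlane (vertex (i + 2) - vertex i))

namespace ConvexLatticePolygon

variable {m : ℕ} (P : ConvexLatticePolygon m)

/-- The vector `A i A (i+1)` that directs the `i`-th side. -/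
def side (i : ZMod m) : Fin 2 → ℝ := toPlane (P.vertex (i + 1) - P.vertex i)

/-- The half-plane `S_{i,0}⁺`: bounded by the line through the origin parallel to the `i`-th side,
on the side where the polygon lies with respect to its `i`-th side. -/
def halfPlane₀ (i : ZMod m) : Set (Fin 2 → ℝ) :=
  {x | 0 ≤ planeDet (P.side i) x *
    planeDet (P.side i) (toPlane (P.vertex (i + 2) - P.vertex i))}

/-- The closed half-plane `S_i⁺` bounded by the line carrying the `i`-th side and containing the
polygon. -/
def halfPlane (i : ZMod m) : Set (Fin 2 → ℝ) :=
  {x | x - toPlane (P.vertex i) ∈ P.halfPlane₀ i}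

/-- The polygon as a subset of `ℝ²`. -/
def region : Set (Fin 2 → ℝ) := convexHull ℝ (Set.range fun i => toPlane (P.vertex i))

/-- The set `Λ` of lattice points of the polygon. -/
def latticePoints : Set (Fin 2 → ℤ) := trace P.region

/-- The half-cone `C_{A,0}⁺` at the origin, for the vertex `A = A i`: the translate of the half-cone
at `A` bounded by the two sides at `A` and containing the polygon. -/
def vertexHalfCone (i : ZMod m) : Set (Fin 2 → ℝ) :=
  halfCone (toPlane (P.vertex (i - 1) - P.vertex i)) (toPlane (P.vertex (i + 1) - P.vertex i))

/-- The cone `C_{A,0}` determined by the lines through the origin parallel to the two sides of the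
polygon at the vertex `A = A i`. -/
def vertexCone (i : ZMod m) : Set (Fin 2 → ℝ) :=
  doubleCone (toPlane (P.vertex (i - 1) - P.vertex i)) (toPlane (P.vertex (i + 1) - P.vertex i))

end ConvexLatticePolygon

/-! ### Factorizations -/

/-- The factorization `f = α ᾱ` relative to the half-cone `C⁺[e₁, e₂]`. -/
structure IsConeFactorization (f : Torus2 → ℝ) (e₁ e₂ : Fin 2 → ℝ) (α : Linfty) : Prop where
  mul_star : ∀ᵐ x ∂torusMeasure, (f x : ℂ) = α x * (star α : Linfty) x
  spec_subset : spec α ⊆ trace (halfCone e₁ e₂)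

/-- `(G i)` is the factorization of `f` associated with the polygon `P`, its vertex `A = P.vertex a`,
and the cone `C = C[e₁, e₂] ⊆ C_{A,0}` (the half-cone `C⁺` being the one inside `C_{A,0}⁺`), built
from `f = α ᾱ`: for every side, `G i` is `α` if `C⁺ ⊆ S_{i,0}⁺` and `ᾱ` if `C⁻ ⊆ S_{i,0}⁺`, one of
the two being the case; `f = G i * conj (G i)`, `(G i)^{±1} ∈ L^∞`, and `spec (G i) ⊆ S_{i,0}⁺`. -/
structure IsAssociatedFactorization {m : ℕ} (f : Torus2 → ℝ) (P : ConvexLatticePolygon m)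
    (a : ZMod m) (e₁ e₂ : Fin 2 → ℝ) (α : Linfty) (G : ZMod m → Linfty) : Prop where
  cone_nondegenerate : LinearIndependent ℝ ![e₁, e₂]
  cone_subset : doubleCone e₁ e₂ ⊆ P.vertexCone a
  halfCone_subset : halfCone e₁ e₂ ⊆ P.vertexHalfCone a
  factorization : IsConeFactorization f e₁ e₂ α
  choice : ∀ i, (halfCone e₁ e₂ ⊆ P.halfPlane₀ i ∧ G i = α) ∨
    (oppositeHalfCone e₁ e₂ ⊆ P.halfPlane₀ i ∧ G i = star α)
  mul_star : ∀ i, ∀ᵐ x ∂torusMeasure, (f x : ℂ) = G i x * (star (G i) : Linfty) x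
  inv_mem : ∀ i, MemLp (fun x => (G i x)⁻¹) ∞ torusMeasure
  spec_subset : ∀ i, spec (G i) ⊆ trace (P.halfPlane₀ i)

/-- A partition of the `m` cyclically numbered sides into `p` consecutive nonempty blocks
`I_1, …, I_p`: after renumbering the sides from `start`, the `j`-th block is the set of the numbers
from `cut j` to `cut (j+1) - 1`, where `0 = cut 0 < cut 1 < ⋯ < cut p = m`. -/
structure CyclicPartition (m p : ℕ) where
  start : ZMod m
  cut : Fin (p + 1) → ℕ
  strictMono : StrictMono cut
  cut_zero : cut 0 = 0
  cut_last : cut (Fin.last p) = m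

namespace CyclicPartition

variable {m p : ℕ} (I : CyclicPartition m p)

/-- The `j`-th block. -/
def block (j : Fin p) : Set (ZMod m) :=
  {k | ∃ t : ℕ, I.cut j.castSucc ≤ t ∧ t < I.cut j.succ ∧ k = I.start + (t : ZMod m)}

/-- The union `𝕊_j⁻` over the `j`-th block of the complements (in `ℤ²`) of the half-planes
`S_k⁺`. -/
def negRegion (P : ConvexLatticePolygon m) (j : Fin p) : Set (Fin 2 → ℤ) :=
  ⋃ k ∈ I.block j, (trace (P.halfPlane k))ᶜ

/-- The complement `𝕊_j⁺` of `𝕊_j⁻` in `ℤ²`. -/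
def posRegion (P : ConvexLatticePolygon m) (j : Fin p) : Set (Fin 2 → ℤ) :=
  (I.negRegion P j)ᶜ

/-- The intersection `𝕊_{j,0}⁺` over the `j`-th block of the half-planes `S_{k,0}⁺`. -/
def posRegion₀ (P : ConvexLatticePolygon m) (j : Fin p) : Set (Fin 2 → ℤ) :=
  ⋂ k ∈ I.block j, trace (P.halfPlane₀ k)

end CyclicPartition

/-- The `p`-tuple `g` is the factorization issued from `(G i)` through the partition `I` of the
sides: `G` takes the value `g j` on the `j`-th block, and cyclically consecutive members of `g` are
distinct elements of `L^∞`. -/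
structure IsDerivedFactorization {m p : ℕ} (I : CyclicPartition m p) (G : ZMod m → Linfty)
    (g : Fin p → Linfty) : Prop where
  two_le : 2 ≤ p
  eq_on_block : ∀ j, ∀ k ∈ I.block j, G k = g j
  ne_next : ∀ j, g j ≠ g (finRotate p j)

/-- A minimal factorization is a derived factorization with `p = 2`. -/
abbrev IsMinimalFactorization {m : ℕ} (I : CyclicPartition m 2) (G : ZMod m → Linfty)
    (g₁ g₂ : Linfty) : Prop :=
  IsDerivedFactorization I G ![g₁, g₂]

open UnitAddTorus Filter Topology

/-! The analytic half builds a bounded `A` with `‖A‖ ^ 2 = f` and spectrum in a lattice cone. For a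
character `w` of frequency in the open cone, `-2w/(1-w)` is a power series in `w` without constant
term, and its real part is `1` wherever `w ≠ 1`. Let `q ≥ 0` be a real trigonometric polynomial. If
the frequency of `w` is deep enough, all frequencies of `q * w` lie in the open cone, so
`exp(-2qw/(1-w))` has modulus `exp q` almost everywhere, mean `1` and spectrum in the cone.
Replacing `w` by `r w` with `r < 1` in the fraction `-2w/(1-w)` gives continuous approximants,
dominated by `exp q` (`exists_trigClosure_approx_modulus_exp`).

Put `F = (log f)/2`. Lower semicontinuity lets trigonometric polynomials approach `F` from below,
and `A` is an infinite product of such factors. As each factor `α` has mean `1`, `∫ ‖α - 1‖ ^ 2 = ∫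
(‖α‖ ^ 2 - 1)`, so the change made by a step is controlled by the deficit of squared modulus left
before it (`IsPartialFactor.exists_next`). With geometrically small deficits the product converges
almost everywhere (`exists_bounded_sq_norm_eq`).

The geometric half narrows the cone at the vertex until its nonzero vectors are parallel to no side
(`exists_lattice_cone`). Each half-plane then contains one of the two half-cones, and which one
depends on the sign of a linear form on the side. By convexity such a form rises along one run of
sides and falls along the other (`exists_cyclicPartition`); this yields the two blocks. Part (3) is
the description of the polygon as the intersection of its half-planes (`region_eq`). -/

instance : IsProbabilityMeasure torusMeasure := by
  unfold torusMeasure; infer_instance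

/-! ### Characters of the torus -/

theorem mFourierCoeff_eq (g : Torus2 → ℂ) (n : Fin 2 → ℤ) :
    mFourierCoeff g n = ∫ x, mFourier (-n) x * g x ∂torusMeasure := rfl

theorem norm_mFourier_apply (n : Fin 2 → ℤ) (x : Torus2) : ‖mFourier n x‖ = 1 := by
  simp only [mFourier, fourier_apply, ContinuousMap.coe_mk, norm_prod, Circle.norm_coe,
    Finset.prod_const_one]

theorem mFourier_add_eq_mul (m n : Fin 2 → ℤ) :
    (mFourier (m + n) : C(Torus2, ℂ)) = mFourier m * mFourier n := by
  ext x; exact mFourier_add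

theorem integral_mFourier_eq_zero {n : Fin 2 → ℤ} (hn : n ≠ 0) :
    ∫ x, mFourier n x ∂torusMeasure = 0 := by
  obtain ⟨i, hi⟩ := Function.ne_iff.mp hn
  have h : ∫ x, mFourier n x ∂torusMeasure =
      ∏ i, ∫ t, fourier (n i) t ∂(AddCircle.haarAddCircle : Measure UnitAddCircle) :=
    integral_fintype_prod_eq_prod (μ := fun _ : Fin 2 => AddCircle.haarAddCircle)
      (fun i t => (fourier (n i) t : ℂ))
  rw [h]
  refine Finset.prod_eq_zero (Finset.mem_univ i) ?_
  exact integral_eq_zero_of_add_right_eq_neg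
    (fourier_add_half_inv_index (T := 1) hi one_pos)

/-! ### Uniform closures of trigonometric polynomials with frequencies in a semigroup -/

/-- The uniform closure of the trigonometric polynomials with frequencies in `S`. -/
noncomputable def trigClosure (S : Set (Fin 2 → ℤ)) : Submodule ℂ C(Torus2, ℂ) :=
  (Submodule.span ℂ (mFourier '' S)).topologicalClosure

theorem isClosed_trigClosure (S : Set (Fin 2 → ℤ)) :
    IsClosed (trigClosure S : Set C(Torus2, ℂ)) :=
  Submodule.isClosed_topologicalClosure _

theorem mFourier_mem_trigClosure {S : Set (Fin 2 → ℤ)} {n : Fin 2 → ℤ} (hn : n ∈ S) :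
    mFourier n ∈ trigClosure S :=
  Submodule.le_topologicalClosure _ (Submodule.subset_span ⟨n, hn, rfl⟩)

section Semigroup

variable {S : Set (Fin 2 → ℤ)}

theorem mul_mem_trigClosure (hS : ∀ m ∈ S, ∀ n ∈ S, m + n ∈ S) {f g : C(Torus2, ℂ)}
    (hf : f ∈ trigClosure S) (hg : g ∈ trigClosure S) : f * g ∈ trigClosure S := by
  refine map_mem_closure₂ (f := fun a b : C(Torus2, ℂ) => a * b) continuous_mul hf hg ?_
  intro a ha b hb
  have h : a * b ∈ Submodule.span ℂ (mFourier '' S) * Submodule.span ℂ (mFourier '' S) :=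
    Submodule.mul_mem_mul ha hb
  rw [Submodule.span_mul_span] at h
  refine Submodule.span_mono ?_ h
  rintro _ ⟨_, ⟨m, hm, rfl⟩, _, ⟨n, hn, rfl⟩, rfl⟩
  exact ⟨m + n, hS m hm n hn, mFourier_add_eq_mul m n⟩

theorem pow_succ_mem_trigClosure (hS : ∀ m ∈ S, ∀ n ∈ S, m + n ∈ S) {f : C(Torus2, ℂ)}
    (hf : f ∈ trigClosure S) (k : ℕ) : f ^ (k + 1) ∈ trigClosure S := by
  induction k with
  | zero => simpa using hf
  | succ k ih => rw [pow_succ]; exact mul_mem_trigClosure hS ih hf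

/-- `0` need not lie in `S`, so the closure is an algebra possibly without unit; the constant term
of the series is therefore split off. -/
theorem exp_sub_one_mem_trigClosure (hS : ∀ m ∈ S, ∀ n ∈ S, m + n ∈ S) {f : C(Torus2, ℂ)}
    (hf : f ∈ trigClosure S) : NormedSpace.exp f - 1 ∈ trigClosure S := by
  have h := NormedSpace.exp_series_hasSum_exp' (𝕂 := ℂ) f
  rw [← hasSum_nat_add_iff' 1] at h
  simp only [Finset.range_one, Finset.sum_singleton, Nat.factorial_zero, Nat.cast_one, inv_one,
    pow_zero, one_smul] at h
  refine (isClosed_trigClosure S).mem_of_tendsto h (Eventually.of_forall fun s => ?_)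
  exact Submodule.sum_mem _ fun k _ =>
    Submodule.smul_mem _ _ (pow_succ_mem_trigClosure hS hf k)

theorem tsum_geometric_sub_one_mem_trigClosure (hS : ∀ m ∈ S, ∀ n ∈ S, m + n ∈ S)
    {f : C(Torus2, ℂ)} (hf : f ∈ trigClosure S) (hf1 : ‖f‖ < 1) :
    (∑' k : ℕ, f ^ k) - 1 ∈ trigClosure S := by
  have h := (summable_geometric_of_norm_lt_one hf1).hasSum
  rw [← hasSum_nat_add_iff' 1] at h
  simp only [Finset.range_one, Finset.sum_singleton, pow_zero] at h
  refine (isClosed_trigClosure S).mem_of_tendsto h (Eventually.of_forall fun s => ?_)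
  exact Submodule.sum_mem _ fun k _ => pow_succ_mem_trigClosure hS hf k

end Semigroup

/-- Pairing with an integrable `A` is a functional continuous for the uniform norm, so its kernel is
closed and it suffices to test characters. -/
theorem integral_mul_eq_zero_of_mem_trigClosure {S : Set (Fin 2 → ℤ)} {A : Torus2 → ℂ}
    (hA : Integrable A torusMeasure) (h : ∀ n ∈ S, ∫ x, mFourier n x * A x ∂torusMeasure = 0)
    {g : C(Torus2, ℂ)} (hg : g ∈ trigClosure S) : ∫ x, g x * A x ∂torusMeasure = 0 := by
  have hint : ∀ g : C(Torus2, ℂ), Integrable (fun x => g x * A x) torusMeasure := fun g =>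
    hA.bdd_mul (c := ‖g‖) g.continuous.aestronglyMeasurable
      (Eventually.of_forall fun x => g.norm_coe_le_norm x)
  let Φ : C(Torus2, ℂ) →L[ℂ] ℂ := LinearMap.mkContinuous
    { toFun := fun g => ∫ x, g x * A x ∂torusMeasure
      map_add' := fun g g' => by
        simp only [ContinuousMap.add_apply, add_mul]
        exact integral_add (hint g) (hint g')
      map_smul' := fun c g => by
        simp only [ContinuousMap.smul_apply, smul_eq_mul, mul_assoc, RingHom.id_apply]
        exact integral_const_mul _ _ }
    (∫ x, ‖A x‖ ∂torusMeasure) (fun g => by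
      rw [mul_comm, ← integral_const_mul]
      refine norm_integral_le_of_norm_le (hA.norm.const_mul _) (Eventually.of_forall fun x => ?_)
      rw [norm_mul]
      exact mul_le_mul_of_nonneg_right (g.norm_coe_le_norm x) (norm_nonneg _))
  have hle : trigClosure S ≤ LinearMap.ker (Φ : C(Torus2, ℂ) →ₗ[ℂ] ℂ) := by
    refine Submodule.topologicalClosure_minimal _ (Submodule.span_le.2 ?_) Φ.isClosed_ker
    rintro _ ⟨n, hn, rfl⟩
    exact h n hn
  exact hle hg

theorem integral_eq_zero_of_mem_trigClosure {S : Set (Fin 2 → ℤ)} (h0 : (0 : Fin 2 → ℤ) ∉ S)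
    {g : C(Torus2, ℂ)} (hg : g ∈ trigClosure S) : ∫ x, g x ∂torusMeasure = 0 := by
  have := integral_mul_eq_zero_of_mem_trigClosure (S := S) (A := fun _ => 1)
    (integrable_const _) (fun n hn => ?_) hg
  · simpa using this
  · simpa using integral_mFourier_eq_zero (fun h => h0 (h ▸ hn))

/-- A trigonometric polynomial has finitely many frequencies, and a large multiple of `v` pushes all
of them into `S`. -/
theorem exists_mul_mFourier_mem_trigClosure {S : Set (Fin 2 → ℤ)} {v : Fin 2 → ℤ}
    (hv : ∀ n : Fin 2 → ℤ, ∃ N₀ : ℕ, ∀ N ≥ N₀, n + N • v ∈ S)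
    {p : C(Torus2, ℂ)} (hp : p ∈ Submodule.span ℂ (Set.range (mFourier (d := Fin 2)))) :
    ∃ N₀ : ℕ, ∀ N ≥ N₀, p * mFourier (N • v) ∈ trigClosure S := by
  induction hp using Submodule.span_induction with
  | mem p hp =>
    obtain ⟨n, rfl⟩ := hp
    obtain ⟨N₀, h⟩ := hv n
    exact ⟨N₀, fun N hN => mFourier_add_eq_mul n (N • v) ▸ mFourier_mem_trigClosure (h N hN)⟩
  | zero => exact ⟨0, fun N _ => by simp⟩
  | add p q _ _ hp hq =>
    obtain ⟨N₁, h₁⟩ := hp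
    obtain ⟨N₂, h₂⟩ := hq
    refine ⟨max N₁ N₂, fun N hN => ?_⟩
    rw [add_mul]
    exact Submodule.add_mem _ (h₁ N ((le_max_left _ _).trans hN))
      (h₂ N ((le_max_right _ _).trans hN))
  | smul c p _ hp =>
    obtain ⟨N₁, h₁⟩ := hp
    refine ⟨N₁, fun N hN => ?_⟩
    rw [smul_mul_assoc]
    exact Submodule.smul_mem _ _ (h₁ N hN)

theorem ContinuousMap.exp_apply_eq (g : C(Torus2, ℂ)) (x : Torus2) :
    (NormedSpace.exp g) x = Complex.exp (g x) := by
  rw [Complex.exp_eq_exp_ℂ]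
  exact NormedSpace.map_exp ((Pi.evalRingHom (fun _ : Torus2 => ℂ) x).comp
    ContinuousMap.coeFnRingHom) (continuous_eval_const x) g

/-! ### Geometric series in a character, and their boundary values -/

/-- The radii `1 - 1 / (k + 1)`, which increase to `1`. -/
noncomputable def radius (k : ℕ) : ℝ := 1 - 1 / ((k : ℝ) + 1)

theorem radius_nonneg (k : ℕ) : 0 ≤ radius k := by
  unfold radius
  rw [sub_nonneg, div_le_one (by positivity)]
  linarith [(Nat.cast_nonneg k : (0 : ℝ) ≤ k)]

theorem radius_lt_one (k : ℕ) : radius k < 1 := by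
  unfold radius
  have : (0 : ℝ) < 1 / ((k : ℝ) + 1) := by positivity
  linarith

theorem tendsto_radius : Tendsto radius atTop (𝓝 1) := by
  unfold radius
  simpa using tendsto_const_nhds.sub (tendsto_one_div_add_atTop_nhds_zero_nat (𝕜 := ℝ))

theorem tendsto_radius_complex : Tendsto (fun k => (radius k : ℂ)) atTop (𝓝 1) :=
  (Complex.continuous_ofReal.tendsto' 1 1 Complex.ofReal_one).comp tendsto_radius

theorem norm_radius_smul_mFourier_lt_one (k : ℕ) (n : Fin 2 → ℤ) :
    ‖((radius k : ℂ) • mFourier n : C(Torus2, ℂ))‖ < 1 := by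
  rw [norm_smul, mFourier_norm, mul_one, Complex.norm_real, Real.norm_of_nonneg (radius_nonneg k)]
  exact radius_lt_one k

theorem one_sub_radius_mul_ne_zero (k : ℕ) {w : ℂ} (hw : ‖w‖ = 1) : 1 - (radius k : ℂ) * w ≠ 0 := by
  intro h
  have h1 : ‖(radius k : ℂ) * w‖ = 1 := by rw [← sub_eq_zero.1 h]; simp
  rw [norm_mul, hw, mul_one, Complex.norm_real, Real.norm_of_nonneg (radius_nonneg k)] at h1
  exact (radius_lt_one k).ne h1

theorem tsum_geometric_apply (k : ℕ) (n : Fin 2 → ℤ) (x : Torus2) :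
    (∑' j : ℕ, ((radius k : ℂ) • mFourier n : C(Torus2, ℂ)) ^ j) x =
      (1 - radius k * mFourier n x)⁻¹ := by
  have h := geom_series_mul_neg _ (norm_radius_smul_mFourier_lt_one k n)
  have hx := congrArg (fun g : C(Torus2, ℂ) => g x) h
  simp only [ContinuousMap.mul_apply, ContinuousMap.sub_apply, ContinuousMap.one_apply,
    ContinuousMap.smul_apply, smul_eq_mul] at hx
  exact eq_inv_of_mul_eq_one_left hx

/-- With `w` the character, `(1 - r)/(1 - r w)` has mean `1 - r` and modulus at most `1`, and as `r
→ 1` it tends to the indicator of `{w = 1}`. Bounded convergence gives that set measure zero. -/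
theorem mFourier_ae_ne_one {S : Set (Fin 2 → ℤ)} (hS : ∀ m ∈ S, ∀ n ∈ S, m + n ∈ S)
    (h0 : (0 : Fin 2 → ℤ) ∉ S) {n : Fin 2 → ℤ} (hn : n ∈ S) :
    ∀ᵐ x ∂torusMeasure, mFourier n x ≠ 1 := by
  set E : Set Torus2 := {x | mFourier n x = 1} with hE
  have hEm : MeasurableSet E := (isClosed_eq (mFourier n).continuous continuous_const).measurableSet
  let F : ℕ → Torus2 → ℂ := fun k x => (1 - radius k) * (1 - radius k * mFourier n x)⁻¹
  have hF : ∀ k, ∫ x, F k x ∂torusMeasure = 1 - radius k := by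
    intro k
    have h1 := tsum_geometric_sub_one_mem_trigClosure hS
      (Submodule.smul_mem _ (radius k : ℂ) (mFourier_mem_trigClosure hn))
      (norm_radius_smul_mFourier_lt_one k n)
    have h2 := integral_eq_zero_of_mem_trigClosure h0 h1
    simp only [ContinuousMap.sub_apply, ContinuousMap.one_apply, tsum_geometric_apply] at h2
    rw [integral_sub, sub_eq_zero] at h2
    · simp only [F]
      rw [integral_const_mul, h2]; simp
    · simp_rw [← tsum_geometric_apply]
      exact (ContinuousMap.continuous _).integrable_of_hasCompactSupport
        (HasCompactSupport.of_compactSpace _)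
    · exact integrable_const _
  have hlim : Tendsto (fun k => ∫ x, F k x ∂torusMeasure) atTop
      (𝓝 (∫ x, E.indicator (fun _ => (1 : ℂ)) x ∂torusMeasure)) := by
    refine tendsto_integral_of_dominated_convergence (fun _ => 1) (fun k => ?_)
      (integrable_const _) (fun k => Eventually.of_forall fun x => ?_)
      (Eventually.of_forall fun x => ?_)
    · have : Measurable (mFourier n : Torus2 → ℂ) := (mFourier n).continuous.measurable
      exact (measurable_const.mul
        (measurable_const.sub (measurable_const.mul this)).inv).aestronglyMeasurable
    · have hw := norm_mFourier_apply n x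
      simp only [F]
      rw [norm_mul, norm_inv, ← div_eq_mul_inv, div_le_one
        (norm_pos_iff.2 (one_sub_radius_mul_ne_zero k hw))]
      have h3 : ‖(1 : ℂ) - radius k‖ = 1 - radius k := by
        rw [← Complex.ofReal_one, ← Complex.ofReal_sub, Complex.norm_real,
          Real.norm_of_nonneg (by linarith [radius_lt_one k])]
      have h4 : ‖(radius k : ℂ) * mFourier n x‖ = radius k := by
        rw [norm_mul, hw, mul_one, Complex.norm_real, Real.norm_of_nonneg (radius_nonneg k)]
      have h5 := norm_sub_norm_le (1 : ℂ) ((radius k : ℂ) * mFourier n x)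
      rw [norm_one, h4] at h5
      rw [h3]; exact h5
    · by_cases hx : x ∈ E
      · rw [Set.indicator_of_mem hx]
        have hx' : mFourier n x = 1 := hx
        refine tendsto_const_nhds.congr fun k => ?_
        have := one_sub_radius_mul_ne_zero k (norm_one (α := ℂ))
        simp only [F, hx', mul_one] at this ⊢
        exact (mul_inv_cancel₀ this).symm
      · rw [Set.indicator_of_notMem hx]
        have h6 : (1 : ℂ) - 1 * mFourier n x ≠ 0 := by
          rw [one_mul, sub_ne_zero]; exact fun h => hx h.symm
        have := (tendsto_const_nhds (x := (1 : ℂ)).sub tendsto_radius_complex).mul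
          ((tendsto_const_nhds (x := (1 : ℂ)).sub
            (tendsto_radius_complex.mul_const (mFourier n x))).inv₀ h6)
        simpa using this
  have hzero : Tendsto (fun k => ∫ x, F k x ∂torusMeasure) atTop (𝓝 0) := by
    simp_rw [hF]
    simpa using (tendsto_const_nhds (x := (1 : ℂ))).sub tendsto_radius_complex
  have h := tendsto_nhds_unique hlim hzero
  rw [integral_indicator hEm, setIntegral_const, Complex.real_smul, mul_one] at h
  have h7 : torusMeasure E = 0 := by
    have : torusMeasure.real E = 0 := by exact_mod_cast h
    rwa [measureReal_eq_zero_iff] at this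
  rw [ae_iff]; simpa [hE] using h7

/-- For `u ≠ 1` this is `1` minus the Poisson kernel `(1 - |u|²)/|1 - u|²`: at most `1` on the
closed disc, equal to `1` on the circle. -/
theorem re_neg_two_mul_div (u : ℂ) : (-2 * u * (1 - u)⁻¹).re =
    (Complex.normSq (1 - u) + (Complex.normSq u - 1)) / Complex.normSq (1 - u) := by
  rw [← div_eq_mul_inv, Complex.div_re, ← add_div]
  congr 1
  simp only [Complex.normSq_apply, Complex.mul_re, Complex.mul_im, Complex.sub_re, Complex.sub_im,
    Complex.neg_re, Complex.neg_im, Complex.one_re, Complex.one_im, Complex.re_ofNat,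
    Complex.im_ofNat]
  ring

theorem re_neg_two_mul_div_le {u : ℂ} (hu : ‖u‖ ≤ 1) : (-2 * u * (1 - u)⁻¹).re ≤ 1 := by
  rcases eq_or_ne u 1 with rfl | h1
  · simp
  have hd : 0 < Complex.normSq (1 - u) := Complex.normSq_pos.2 (sub_ne_zero.2 h1.symm)
  have hu2 : Complex.normSq u ≤ 1 := by
    rw [Complex.normSq_eq_norm_sq]; exact pow_le_one₀ (norm_nonneg _) hu
  rw [re_neg_two_mul_div, div_le_one hd]
  linarith

theorem re_neg_two_mul_div_eq {u : ℂ} (hu : ‖u‖ = 1) (h1 : u ≠ 1) :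
    (-2 * u * (1 - u)⁻¹).re = 1 := by
  have hd : 0 < Complex.normSq (1 - u) := Complex.normSq_pos.2 (sub_ne_zero.2 h1.symm)
  rw [re_neg_two_mul_div, Complex.normSq_eq_norm_sq u, hu, one_pow, sub_self, add_zero,
    div_self hd.ne']

/-! ### Bounded functions with spectrum in the cone and modulus the exponential of a trigonometric
polynomial -/

theorem exists_trigClosure_approx_modulus_exp {S : Set (Fin 2 → ℤ)} {v : Fin 2 → ℤ}
    (hS : ∀ m ∈ S, ∀ n ∈ S, m + n ∈ S) (h0 : (0 : Fin 2 → ℤ) ∉ S)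
    (hv : ∀ n : Fin 2 → ℤ, ∃ N₀ : ℕ, ∀ N ≥ N₀, n + N • v ∈ S)
    {p : C(Torus2, ℂ)} (hp : p ∈ Submodule.span ℂ (Set.range (mFourier (d := Fin 2))))
    {q : Torus2 → ℝ} (hpq : ∀ x, p x = (q x : ℂ)) (hq : ∀ x, 0 ≤ q x) :
    ∃ (α : Torus2 → ℂ) (β : ℕ → C(Torus2, ℂ)), Measurable α ∧
      (∀ᵐ x ∂torusMeasure, ‖α x‖ = Real.exp (q x)) ∧
      (∀ k, β k - 1 ∈ trigClosure S) ∧ (∀ k x, ‖β k x‖ ≤ Real.exp (q x)) ∧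
      ∀ᵐ x ∂torusMeasure, Tendsto (fun k => β k x) atTop (𝓝 (α x)) := by
  obtain ⟨N₁, h₁⟩ := exists_mul_mFourier_mem_trigClosure hv hp
  obtain ⟨N₂, h₂⟩ := hv 0
  -- One multiple of `v` serves two purposes: `n` itself lies in `S`, and so do its sums with the
  -- frequencies of `p`.
  set n : Fin 2 → ℤ := max N₁ N₂ • v with hn
  have hnS : n ∈ S := by
    have := h₂ (max N₁ N₂) (le_max_right _ _)
    rwa [zero_add] at this
  have hpn : p * mFourier n ∈ trigClosure S := h₁ _ (le_max_left _ _)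
  let E : ℕ → C(Torus2, ℂ) := fun k => ∑' j : ℕ, ((radius k : ℂ) • mFourier n) ^ j
  have hE : ∀ k, p * mFourier n * E k ∈ trigClosure S := by
    intro k
    have h3 := tsum_geometric_sub_one_mem_trigClosure hS
      (Submodule.smul_mem _ (radius k : ℂ) (mFourier_mem_trigClosure hnS))
      (norm_radius_smul_mFourier_lt_one k n)
    have h4 := Submodule.add_mem _ hpn (mul_mem_trigClosure hS hpn h3)
    convert h4 using 1
    ring
  let G : ℕ → C(Torus2, ℂ) := fun k => (-2 * (radius k : ℂ)) • (p * mFourier n * E k)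
  have hGx : ∀ k x, G k x = (q x : ℂ) *
      (-2 * (radius k * mFourier n x) * (1 - radius k * mFourier n x)⁻¹) := by
    intro k x
    simp only [G, E, ContinuousMap.smul_apply, ContinuousMap.mul_apply, tsum_geometric_apply, hpq,
      smul_eq_mul]
    ring
  refine ⟨fun x => Complex.exp ((q x : ℂ) * (-2 * mFourier n x * (1 - mFourier n x)⁻¹)),
    fun k => NormedSpace.exp (G k), ?_, ?_, fun k =>
      exp_sub_one_mem_trigClosure hS (Submodule.smul_mem _ _ (hE k)), fun k x => ?_, ?_⟩
  · have hw : Measurable (mFourier n : Torus2 → ℂ) := (mFourier n).continuous.measurable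
    simp_rw [← hpq]
    exact Complex.measurable_exp.comp (p.continuous.measurable.mul
      ((measurable_const.mul hw).mul (measurable_const.sub hw).inv))
  · filter_upwards [mFourier_ae_ne_one hS h0 hnS] with x hx
    rw [Complex.norm_exp, Complex.re_ofReal_mul,
      re_neg_two_mul_div_eq (norm_mFourier_apply n x) hx, mul_one]
  · rw [ContinuousMap.exp_apply_eq, Complex.norm_exp, hGx, Complex.re_ofReal_mul]
    refine Real.exp_le_exp.2 (mul_le_of_le_one_right (hq x) (re_neg_two_mul_div_le ?_))
    rw [norm_mul, norm_mFourier_apply, mul_one, Complex.norm_real,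
      Real.norm_of_nonneg (radius_nonneg k)]
    exact (radius_lt_one k).le
  · filter_upwards [mFourier_ae_ne_one hS h0 hnS] with x hx
    simp_rw [ContinuousMap.exp_apply_eq, hGx]
    have hr : Tendsto (fun k => (radius k : ℂ) * mFourier n x) atTop (𝓝 (mFourier n x)) := by
      simpa using tendsto_radius_complex.mul_const (mFourier n x)
    refine (Complex.continuous_exp.tendsto _).comp (Tendsto.const_mul _ ?_)
    exact (hr.const_mul _).mul ((tendsto_const_nhds.sub hr).inv₀ (sub_ne_zero.2 (Ne.symm hx)))

/-! ### Approximation of lower semicontinuous functions from below -/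

section InfConvolution

variable {X : Type*} [MetricSpace X]

/-- The Lipschitz regularization `x ↦ inf_y (F y + n d(x, y))` of a function. -/
noncomputable def infConvolution (F : X → ℝ) (n : ℕ) (x : X) : ℝ := ⨅ y, (F y + n * dist x y)

variable {F : X → ℝ} {δ : ℝ}

theorem bddBelow_infConvolution (hδ : ∀ y, δ ≤ F y) (n : ℕ) (x : X) :
    BddBelow (Set.range fun y => F y + n * dist x y) :=
  ⟨δ, by rintro _ ⟨y, rfl⟩; exact (hδ y).trans (le_add_of_nonneg_right (by positivity))⟩

theorem infConvolution_le (hδ : ∀ y, δ ≤ F y) (n : ℕ) (x : X) : infConvolution F n x ≤ F x := by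
  have h := ciInf_le (bddBelow_infConvolution hδ n x) x
  rwa [dist_self, mul_zero, add_zero] at h

theorem le_infConvolution (hδ : ∀ y, δ ≤ F y) (n : ℕ) (x : X) : δ ≤ infConvolution F n x :=
  have : Nonempty X := ⟨x⟩
  le_ciInf fun y => (hδ y).trans (le_add_of_nonneg_right (by positivity))

theorem continuous_infConvolution (hδ : ∀ y, δ ≤ F y) (n : ℕ) :
    Continuous (infConvolution F n) := by
  refine (LipschitzWith.of_le_add_mul (n : NNReal) fun x x' => ?_).continuous
  have : Nonempty X := ⟨x⟩
  rw [← sub_le_iff_le_add]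
  refine le_ciInf fun y => ?_
  rw [sub_le_iff_le_add]
  refine (ciInf_le (bddBelow_infConvolution hδ n x) y).trans ?_
  have h := mul_le_mul_of_nonneg_left (dist_triangle x x' y) (Nat.cast_nonneg (α := ℝ) n)
  simp only [NNReal.coe_natCast]
  linarith

/-- Near `x`, semicontinuity keeps `F y` above any level below `F x`; away from `x`, the penalty `n
* dist x y` outweighs the lower bound `δ`. -/
theorem tendsto_infConvolution (hF : LowerSemicontinuous F) (hδ : ∀ y, δ ≤ F y) (x : X) :
    Tendsto (fun n => infConvolution F n x) atTop (𝓝 (F x)) := by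
  refine tendsto_order.2 ⟨fun a ha => ?_, fun a ha =>
    Eventually.of_forall fun n => (infConvolution_le hδ n x).trans_lt ha⟩
  obtain ⟨b, hab, hb⟩ := exists_between ha
  obtain ⟨r, hr, hball⟩ := Metric.eventually_nhds_iff.1 (hF x b hb)
  obtain ⟨N, hN⟩ := exists_nat_ge ((b - δ) / r)
  filter_upwards [eventually_ge_atTop N] with n hn
  refine hab.trans_le ?_
  have : Nonempty X := ⟨x⟩
  refine le_ciInf fun y => ?_
  by_cases hy : dist y x < r
  · exact (hball hy).le.trans (le_add_of_nonneg_right (by positivity))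
  · rw [not_lt, dist_comm] at hy
    have h1 : b - δ ≤ n * r := by
      rw [div_le_iff₀ hr] at hN
      exact hN.trans (mul_le_mul_of_nonneg_right (by exact_mod_cast hn) hr.le)
    have h2 : (n : ℝ) * r ≤ n * dist x y := mul_le_mul_of_nonneg_left hy (Nat.cast_nonneg n)
    linarith [hδ y]

end InfConvolution

theorem star_mem_span_mFourier {p : C(Torus2, ℂ)}
    (hp : p ∈ Submodule.span ℂ (Set.range (mFourier (d := Fin 2)))) :
    star p ∈ Submodule.span ℂ (Set.range (mFourier (d := Fin 2))) := by
  induction hp using Submodule.span_induction with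
  | mem p hp =>
    obtain ⟨n, rfl⟩ := hp
    refine Submodule.subset_span ⟨-n, ?_⟩
    ext x
    exact mFourier_neg
  | zero => simp
  | add p q _ _ hp hq => rw [star_add]; exact Submodule.add_mem _ hp hq
  | smul c p _ hp => rw [star_smul]; exact Submodule.smul_mem _ _ hp

theorem exists_real_trig_near {h : Torus2 → ℝ} (hh : Continuous h) {η : ℝ} (hη : 0 < η) :
    ∃ (p : C(Torus2, ℂ)) (q : Torus2 → ℝ),
      p ∈ Submodule.span ℂ (Set.range (mFourier (d := Fin 2))) ∧ (∀ x, p x = (q x : ℂ)) ∧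
      ∀ x, |q x - h x| < η := by
  let H : C(Torus2, ℂ) := ⟨fun x => (h x : ℂ), by fun_prop⟩
  have hH : H ∈ closure
      (Submodule.span ℂ (Set.range (mFourier (d := Fin 2))) : Set C(Torus2, ℂ)) := by
    rw [← Submodule.topologicalClosure_coe, span_mFourier_closure_eq_top]
    trivial
  obtain ⟨T, hT, hTH⟩ := Metric.mem_closure_iff.1 hH η hη
  refine ⟨(1 / 2 : ℂ) • (T + star T), fun x => (T x).re,
    Submodule.smul_mem _ _ (Submodule.add_mem _ hT (star_mem_span_mFourier hT)), fun x => ?_,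
    fun x => ?_⟩
  · simp only [ContinuousMap.smul_apply, ContinuousMap.add_apply, ContinuousMap.star_apply,
      smul_eq_mul]
    rw [Complex.re_eq_add_conj, starRingEnd_apply]
    ring
  · have h1 : ‖(H - T) x‖ < η :=
      ((H - T).norm_coe_le_norm x).trans_lt (by rwa [← dist_eq_norm])
    have h2 := (Complex.abs_re_le_norm ((H - T) x)).trans_lt h1
    rw [abs_sub_comm]
    simpa [H] using h2

/-- A strictly positive lower semicontinuous function on the torus is the pointwise limit of
strictly positive trigonometric polynomials lying strictly below it. -/
theorem exists_trig_tendsto_of_lowerSemicontinuous {F : Torus2 → ℝ} (hF : LowerSemicontinuous F)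
    (hpos : ∀ x, 0 < F x) :
    ∃ (p : ℕ → C(Torus2, ℂ)) (q : ℕ → Torus2 → ℝ),
      (∀ k, p k ∈ Submodule.span ℂ (Set.range (mFourier (d := Fin 2)))) ∧
      (∀ k x, p k x = (q k x : ℂ)) ∧ (∀ k x, 0 < q k x) ∧ (∀ k x, q k x < F x) ∧
      ∀ x, Tendsto (fun k => q k x) atTop (𝓝 (F x)) := by
  obtain ⟨x₀, -, hx₀⟩ := LowerSemicontinuousOn.exists_isMinOn Set.univ_nonempty isCompact_univ
    (hF.lowerSemicontinuousOn Set.univ)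
  have hδ : ∀ y, F x₀ ≤ F y := fun y => hx₀ (Set.mem_univ y)
  set δ := F x₀
  have hδ0 : 0 < δ := hpos x₀
  -- Approximating the regularization minus `2η` to within `η` leaves `q` between `3η` and `η` below
  -- it; `3η ≤ 3δ/4` keeps `q` positive.
  let η : ℕ → ℝ := fun k => δ / 4 * (1 / ((k : ℝ) + 1))
  have hη0 : ∀ k, 0 < η k := fun k => by positivity
  have hη1 : ∀ k, η k ≤ δ / 4 := fun k => by
    refine mul_le_of_le_one_right (by positivity) ?_
    rw [div_le_one (by positivity)]
    linarith [(Nat.cast_nonneg k : (0 : ℝ) ≤ k)]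
  have hηlim : Tendsto η atTop (𝓝 0) := by
    have h := (tendsto_one_div_add_atTop_nhds_zero_nat (𝕜 := ℝ)).const_mul (δ / 4)
    rwa [mul_zero] at h
  choose p q hp hpq hq using fun k => exists_real_trig_near
    ((continuous_infConvolution hδ k).sub (continuous_const (y := 2 * η k))) (hη0 k)
  simp only [Pi.sub_apply] at hq
  refine ⟨p, q, hp, hpq, fun k x => ?_, fun k x => ?_, fun x => ?_⟩
  · linarith [(abs_lt.1 (hq k x)).1, le_infConvolution hδ k x, hη1 k]
  · linarith [(abs_lt.1 (hq k x)).2, infConvolution_le hδ k x, hη0 k]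
  · have hl := tendsto_infConvolution hF hδ x
    refine tendsto_of_tendsto_of_tendsto_of_le_of_le
      (g := fun k => infConvolution F k x - 3 * η k) (h := fun k => infConvolution F k x) ?_ hl
      (fun k => ?_) (fun k => ?_)
    · simpa using hl.sub (hηlim.const_mul 3)
    · show infConvolution F k x - 3 * η k ≤ q k x
      linarith [(abs_lt.1 (hq k x)).1]
    · show q k x ≤ infConvolution F k x
      linarith [(abs_lt.1 (hq k x)).2, hη0 k]

/-! ### Means and Fourier coefficients of bounded limits -/

theorem tendsto_integral_of_norm_bounded {E : Type*} [NormedAddCommGroup E] [NormedSpace ℝ E]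
    {G : ℕ → Torus2 → E} {g : Torus2 → E} (B : ℝ)
    (hG : ∀ k, AEStronglyMeasurable (G k) torusMeasure)
    (hB : ∀ k, ∀ᵐ x ∂torusMeasure, ‖G k x‖ ≤ B)
    (hlim : ∀ᵐ x ∂torusMeasure, Tendsto (fun k => G k x) atTop (𝓝 (g x))) :
    Tendsto (fun k => ∫ x, G k x ∂torusMeasure) atTop (𝓝 (∫ x, g x ∂torusMeasure)) :=
  tendsto_integral_of_dominated_convergence (fun _ => B) hG (integrable_const B) hB hlim

theorem integral_limit_of_trigClosure_eq_one {S : Set (Fin 2 → ℤ)} (h0 : (0 : Fin 2 → ℤ) ∉ S)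
    {α : Torus2 → ℂ} {β : ℕ → C(Torus2, ℂ)} (hβ : ∀ k, β k - 1 ∈ trigClosure S) {B : ℝ}
    (hB : ∀ k x, ‖β k x‖ ≤ B)
    (hlim : ∀ᵐ x ∂torusMeasure, Tendsto (fun k => β k x) atTop (𝓝 (α x))) :
    ∫ x, α x ∂torusMeasure = 1 := by
  have h := tendsto_integral_of_norm_bounded B
    (fun k => (β k).continuous.aestronglyMeasurable) (fun k => Eventually.of_forall (hB k)) hlim
  refine tendsto_nhds_unique h (tendsto_const_nhds.congr fun k => ?_)
  have h1 := integral_eq_zero_of_mem_trigClosure h0 (hβ k)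
  simp only [ContinuousMap.sub_apply, ContinuousMap.one_apply] at h1
  rw [integral_sub _ (integrable_const _), sub_eq_zero] at h1
  · simp [h1]
  · exact (β k).continuous.integrable_of_hasCompactSupport (HasCompactSupport.of_compactSpace _)

/-- The hypothesis `hC` says `C + S ⊆ C`. Hence multiplying `A` by `β k`, which is `1` plus
frequencies in `S`, creates no frequency outside `C`, and the limit inherits this. -/
theorem mFourierCoeff_mul_limit_of_trigClosure {S C : Set (Fin 2 → ℤ)}
    (hC : ∀ n ∉ C, ∀ m ∈ S, n - m ∉ C) {A : Torus2 → ℂ} (hA : Measurable A) {B B' : ℝ}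
    (hAB : ∀ᵐ x ∂torusMeasure, ‖A x‖ ≤ B) (hspec : ∀ n ∉ C, mFourierCoeff A n = 0)
    {α : Torus2 → ℂ} {β : ℕ → C(Torus2, ℂ)} (hβ : ∀ k, β k - 1 ∈ trigClosure S)
    (hB : ∀ k x, ‖β k x‖ ≤ B')
    (hlim : ∀ᵐ x ∂torusMeasure, Tendsto (fun k => β k x) atTop (𝓝 (α x)))
    {n : Fin 2 → ℤ} (hn : n ∉ C) : mFourierCoeff (fun x => A x * α x) n = 0 := by
  have hm : ∀ n : Fin 2 → ℤ, Measurable fun x => mFourier n x * A x := fun n =>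
    (mFourier n).continuous.measurable.mul hA
  have hint : ∀ n : Fin 2 → ℤ, Integrable (fun x => mFourier n x * A x) torusMeasure := fun n =>
    Integrable.of_bound (hm n).aestronglyMeasurable B (by
      filter_upwards [hAB] with x hx
      rwa [norm_mul, norm_mFourier_apply, one_mul])
  have h : Tendsto (fun k => ∫ x, mFourier (-n) x * A x * β k x ∂torusMeasure) atTop
      (𝓝 (∫ x, mFourier (-n) x * A x * α x ∂torusMeasure)) := by
    refine tendsto_integral_of_norm_bounded (B * B')
      (fun k => ((hm _).mul (β k).continuous.measurable).aestronglyMeasurable) (fun k => ?_) ?_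
    · filter_upwards [hAB] with x hx
      rw [norm_mul, norm_mul, norm_mFourier_apply, one_mul]
      exact mul_le_mul hx (hB k x) (norm_nonneg _) ((norm_nonneg _).trans hx)
    · filter_upwards [hlim] with x hx
      exact hx.const_mul _
  rw [mFourierCoeff_eq]
  simp_rw [← mul_assoc]
  refine tendsto_nhds_unique h (tendsto_const_nhds.congr fun k => ?_)
  have h1 := integral_mul_eq_zero_of_mem_trigClosure (hint (-n)) (fun m hm => ?_) (hβ k)
  · have h2 : ∫ x, mFourier (-n) x * A x ∂torusMeasure = 0 := hspec n hn
    have h3 : ∫ x, ((β k - 1) x * (mFourier (-n) x * A x) + mFourier (-n) x * A x)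
        ∂torusMeasure = 0 := by
      rw [integral_add _ (hint _), h1, h2, add_zero]
      exact (hint (-n)).bdd_mul (c := ‖β k - 1‖) (β k - 1).continuous.aestronglyMeasurable
        (Eventually.of_forall fun x => (β k - 1).norm_coe_le_norm x)
    rw [← h3]
    refine integral_congr_ae (Eventually.of_forall fun x => ?_)
    simp only [ContinuousMap.sub_apply, ContinuousMap.one_apply]
    ring
  · have h4 := hspec (n - m) (hC n hn m hm)
    rw [mFourierCoeff_eq] at h4
    rw [← h4]
    refine integral_congr_ae (Eventually.of_forall fun x => ?_)
    show mFourier m x * (mFourier (-n) x * A x) = mFourier (-(n - m)) x * A x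
    rw [neg_sub, sub_eq_add_neg, mFourier_add]
    ring

/-- Mean `1` fixes the cross term: `α - 1` is orthogonal to constants. This turns control of the
modulus into control of `α` itself. -/
theorem integral_norm_sub_one_sq {α : Torus2 → ℂ} (hα : Measurable α) {B : ℝ}
    (hB : ∀ᵐ x ∂torusMeasure, ‖α x‖ ≤ B) (h1 : ∫ x, α x ∂torusMeasure = 1) :
    ∫ x, ‖α x - 1‖ ^ 2 ∂torusMeasure = ∫ x, (‖α x‖ ^ 2 - 1) ∂torusMeasure := by
  have hint : Integrable α torusMeasure := Integrable.of_bound hα.aestronglyMeasurable B hB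
  have hsq : Integrable (fun x => ‖α x‖ ^ 2) torusMeasure := by
    refine Integrable.of_bound (hα.norm.pow_const 2).aestronglyMeasurable (B ^ 2) ?_
    filter_upwards [hB] with x hx
    rw [norm_pow, norm_norm]
    exact pow_le_pow_left₀ (norm_nonneg _) hx 2
  have hre : ∫ x, (α x).re ∂torusMeasure = 1 := by
    have := integral_re hint
    simp only [RCLike.re_to_complex] at this
    rw [this, h1, Complex.one_re]
  have h2 : ∀ x, ‖α x - 1‖ ^ 2 = (‖α x‖ ^ 2 - 1) + (2 - 2 * (α x).re) := fun x => by
    rw [← Complex.normSq_eq_norm_sq, ← Complex.normSq_eq_norm_sq, Complex.normSq_apply,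
      Complex.normSq_apply]
    simp only [Complex.sub_re, Complex.sub_im, Complex.one_re, Complex.one_im]
    ring
  have hint' : Integrable (fun x => 2 * (α x).re) torusMeasure := hint.re.const_mul 2
  have hi₁ : Integrable (fun x => ‖α x‖ ^ 2 - 1) torusMeasure := hsq.sub (integrable_const _)
  have hi₂ : Integrable (fun x => 2 - 2 * (α x).re) torusMeasure :=
    (integrable_const _).sub hint'
  simp_rw [h2]
  rw [integral_add hi₁ hi₂, integral_sub (integrable_const _) hint', integral_const_mul, hre]
  simp

/-! ### The iterative construction of a function with prescribed modulus -/

/-- `A` is a bounded function with spectrum in `C` and `‖A‖ = exp g` almost everywhere, for a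
continuous function `g` lying strictly below `F` and above the constant `c`. -/
structure IsPartialFactor (C : Set (Fin 2 → ℤ)) (F : Torus2 → ℝ) (c : ℝ) (A : Torus2 → ℂ)
    (g : Torus2 → ℝ) : Prop where
  measurable : Measurable A
  continuous : Continuous g
  norm_eq : ∀ᵐ x ∂torusMeasure, ‖A x‖ = Real.exp (g x)
  lt : ∀ x, g x < F x
  le : ∀ x, c ≤ g x
  coeff_eq_zero : ∀ n ∉ C, mFourierCoeff A n = 0

/-- Multiply `A` by a factor `α` of modulus `exp q`, with `q` a trigonometric polynomial just below
`F - g`. Then `‖A‖ ^ 2 ≤ M`, and `∫ ‖α - 1‖ ^ 2 = ∫ (exp (2q) - 1)` is at most `exp (-2c)` times the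
old deficit, because `c ≤ g` and `g + q < F`. -/
theorem IsPartialFactor.exists_next {S C : Set (Fin 2 → ℤ)} {v : Fin 2 → ℤ}
    (hS : ∀ m ∈ S, ∀ n ∈ S, m + n ∈ S) (h0 : (0 : Fin 2 → ℤ) ∉ S)
    (hv : ∀ n : Fin 2 → ℤ, ∃ N₀ : ℕ, ∀ N ≥ N₀, n + N • v ∈ S)
    (hC : ∀ n ∉ C, ∀ m ∈ S, n - m ∉ C) {F : Torus2 → ℝ} {c M : ℝ} (hF : LowerSemicontinuous F)
    (hFM : ∀ᵐ x ∂torusMeasure, Real.exp (2 * F x) ≤ M) {A : Torus2 → ℂ} {g : Torus2 → ℝ}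
    (h : IsPartialFactor C F c A g) {ε : ℝ} (hε : 0 < ε) :
    ∃ A' g', IsPartialFactor C F c A' g' ∧
      ∫ x, (Real.exp (2 * F x) - Real.exp (2 * g' x)) ∂torusMeasure ≤ ε ∧
      ∫ x, ‖A' x - A x‖ ^ 2 ∂torusMeasure ≤ M * Real.exp (-2 * c) *
        ∫ x, (Real.exp (2 * F x) - Real.exp (2 * g x)) ∂torusMeasure := by
  have hFm : Measurable F := hF.measurable
  have hFg : LowerSemicontinuous fun x => F x + -g x :=
    hF.add h.continuous.neg.lowerSemicontinuous
  obtain ⟨p, q, hp, hpq, hq0, hqF, hqlim⟩ := exists_trig_tendsto_of_lowerSemicontinuous hFg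
    (fun x => by linarith [h.lt x])
  have hqc : ∀ k, Continuous (q k) := fun k => by
    have : q k = fun x => (p k x).re := by ext x; simp [hpq]
    rw [this]
    exact Complex.continuous_re.comp (p k).continuous
  have hbd : ∀ u : Torus2 → ℝ, (∀ x, u x ≤ F x) → ∀ᵐ x ∂torusMeasure,
      ‖Real.exp (2 * F x) - Real.exp (2 * u x)‖ ≤ M := fun u hu => by
    filter_upwards [hFM] with x hx
    have h1 : Real.exp (2 * u x) ≤ Real.exp (2 * F x) := Real.exp_le_exp.2 (by linarith [hu x])
    rw [Real.norm_of_nonneg (sub_nonneg.2 h1)]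
    linarith [Real.exp_pos (2 * u x)]
  have hintd : ∀ u : Torus2 → ℝ, Continuous u → (∀ x, u x ≤ F x) →
      Integrable (fun x => Real.exp (2 * F x) - Real.exp (2 * u x)) torusMeasure :=
    fun u huc hu => Integrable.of_bound
      (by fun_prop) M (hbd u hu)
  have hgq : ∀ k x, g x + q k x < F x := fun k x => by linarith [hqF k x]
  obtain ⟨k, hk⟩ : ∃ k, ∫ x, (Real.exp (2 * F x) - Real.exp (2 * (g x + q k x))) ∂torusMeasure
      < ε := by
    have hl := tendsto_integral_of_norm_bounded (g := fun _ => (0 : ℝ)) M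
      (fun k => (hintd _ (h.continuous.add (hqc k)) (fun x => (hgq k x).le)).aestronglyMeasurable)
      (fun k => hbd _ (fun x => (hgq k x).le)) (Eventually.of_forall fun x => ?_)
    · rw [integral_zero] at hl
      exact (hl.eventually_lt_const hε).exists
    · have h1 := ((hqlim x).const_add (g x)).const_mul 2
      have h2 := ((Real.continuous_exp.tendsto _).comp h1).const_sub (Real.exp (2 * F x))
      rw [show g x + (F x + -g x) = F x by ring, sub_self] at h2
      exact h2
  obtain ⟨α, β, hα, hαn, hβ, hβn, hlim⟩ := exists_trigClosure_approx_modulus_exp hS h0 hv (hp k)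
    (hpq k) (fun x => (hq0 k x).le)
  obtain ⟨Q, hQ⟩ : ∃ Q, ∀ x, Real.exp (q k x) ≤ Q := by
    obtain ⟨Q, hQ⟩ := (isCompact_range (Real.continuous_exp.comp (hqc k))).bddAbove
    exact ⟨Q, fun x => hQ ⟨x, rfl⟩⟩
  have hβB : ∀ k x, ‖β k x‖ ≤ Q := fun k x => (hβn k x).trans (hQ x)
  have hαB : ∀ᵐ x ∂torusMeasure, ‖α x‖ ≤ Q := by
    filter_upwards [hαn] with x hx
    exact hx.trans_le (hQ x)
  have hM0 : 0 ≤ M := by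
    obtain ⟨x, hx⟩ := hFM.exists
    exact (Real.exp_pos _).le.trans hx
  have hA2 : ∀ᵐ x ∂torusMeasure, ‖A x‖ ^ 2 ≤ M := by
    filter_upwards [h.norm_eq, hFM] with x hx hx'
    rw [hx, ← Real.exp_nat_mul]
    refine le_trans (Real.exp_le_exp.2 ?_) hx'
    push_cast
    linarith [h.lt x]
  refine ⟨fun x => A x * α x, fun x => g x + q k x, ⟨h.measurable.mul hα,
    h.continuous.add (hqc k), ?_, hgq k, fun x => by linarith [h.le x, hq0 k x], fun n hn => ?_⟩,
    hk.le, ?_⟩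
  · filter_upwards [h.norm_eq, hαn] with x hx hx'
    rw [norm_mul, hx, hx', Real.exp_add]
  · refine mFourierCoeff_mul_limit_of_trigClosure hC h.measurable (B := M + 1) ?_ h.coeff_eq_zero
      hβ hβB hlim hn
    filter_upwards [hA2] with x hx
    nlinarith [sq_nonneg (‖A x‖ - 1)]
  · have h1 : ∫ x, ‖A x * α x - A x‖ ^ 2 ∂torusMeasure ≤
        ∫ x, M * ‖α x - 1‖ ^ 2 ∂torusMeasure := by
      refine integral_mono_of_nonneg (Eventually.of_forall fun x => by positivity) ?_ ?_
      · refine Integrable.const_mul ?_ M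
        refine Integrable.of_bound
          ((hα.sub measurable_const).norm.pow_const 2).aestronglyMeasurable ((Q + 1) ^ 2) ?_
        filter_upwards [hαB] with x hx
        rw [norm_pow, norm_norm]
        refine pow_le_pow_left₀ (norm_nonneg _) ((norm_sub_le _ _).trans ?_) 2
        rw [norm_one]
        linarith
      · filter_upwards [hA2] with x hx
        rw [show A x * α x - A x = A x * (α x - 1) by ring, norm_mul, mul_pow]
        exact mul_le_mul_of_nonneg_right hx (by positivity)
    refine h1.trans ?_
    rw [integral_const_mul, mul_assoc]
    refine mul_le_mul_of_nonneg_left ?_ hM0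
    rw [integral_norm_sub_one_sq hα hαB (integral_limit_of_trigClosure_eq_one h0 hβ hβB hlim),
      ← integral_const_mul]
    refine integral_mono_ae ?_ ?_ ?_
    · refine Integrable.of_bound
        ((hα.norm.pow_const 2).sub measurable_const).aestronglyMeasurable (Q ^ 2 + 1) ?_
      filter_upwards [hαB] with x hx
      refine (norm_sub_le _ _).trans ?_
      rw [norm_pow, norm_norm, norm_one]
      gcongr
    · exact (hintd g h.continuous (fun x => (h.lt x).le)).const_mul _
    · filter_upwards [hαn] with x hx
      have e1 : Real.exp (2 * (g x + q k x)) ≤ Real.exp (2 * F x) :=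
        Real.exp_le_exp.2 (by linarith [hgq k x])
      have e2 : Real.exp (2 * (g x + q k x)) = Real.exp (2 * g x) * Real.exp (q k x) ^ 2 := by
        rw [← Real.exp_nat_mul, ← Real.exp_add]
        push_cast
        ring_nf
      have e3 : 1 ≤ Real.exp (-2 * c) * Real.exp (2 * g x) := by
        rw [← Real.exp_add]
        exact Real.one_le_exp (by linarith [h.le x])
      have e4 : 0 ≤ Real.exp (q k x) ^ 2 - 1 :=
        sub_nonneg.2 (one_le_pow₀ (Real.one_le_exp (hq0 k x).le))
      rw [hx]
      calc Real.exp (q k x) ^ 2 - 1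
          ≤ Real.exp (-2 * c) * Real.exp (2 * g x) * (Real.exp (q k x) ^ 2 - 1) :=
            le_mul_of_one_le_left e4 e3
        _ = Real.exp (-2 * c) * (Real.exp (2 * (g x + q k x)) - Real.exp (2 * g x)) := by
            rw [e2]; ring
        _ ≤ _ := mul_le_mul_of_nonneg_left (by linarith) (Real.exp_pos _).le

/-- The square integrals decay like `4⁻ʲ`, so the increments have summable `L¹` norms and the
telescoping series converges absolutely almost everywhere. -/
theorem ae_exists_tendsto_of_integral_norm_sub_sq_le {A : ℕ → Torus2 → ℂ} {K B : ℝ}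
    (hA : ∀ j, Measurable (A j)) (hB : ∀ j, ∀ᵐ x ∂torusMeasure, ‖A j x‖ ≤ B)
    (h : ∀ j, ∫ x, ‖A (j + 1) x - A j x‖ ^ 2 ∂torusMeasure ≤ K * (1 / 4) ^ j) :
    ∀ᵐ x ∂torusMeasure, ∃ l, Tendsto (fun j => A j x) atTop (𝓝 l) := by
  have hm : ∀ j, Measurable fun x => ‖A (j + 1) x - A j x‖ := fun j =>
    ((hA (j + 1)).sub (hA j)).norm
  have hbd : ∀ j, ∀ᵐ x ∂torusMeasure, ‖A (j + 1) x - A j x‖ ≤ 2 * B := fun j => by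
    filter_upwards [hB j, hB (j + 1)] with x h1 h2
    exact (norm_sub_le _ _).trans (by linarith)
  have hint : ∀ j, Integrable (fun x => ‖A (j + 1) x - A j x‖) torusMeasure := fun j =>
    Integrable.of_bound (hm j).aestronglyMeasurable (2 * B) (by simpa using hbd j)
  have hint2 : ∀ j, Integrable (fun x => ‖A (j + 1) x - A j x‖ ^ 2) torusMeasure := fun j =>
    Integrable.of_bound ((hm j).pow_const 2).aestronglyMeasurable ((2 * B) ^ 2) (by
      filter_upwards [hbd j] with x hx
      rw [norm_pow, norm_norm]
      exact pow_le_pow_left₀ (norm_nonneg _) hx 2)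
  have hl1 : ∀ j, ∫ x, ‖A (j + 1) x - A j x‖ ∂torusMeasure ≤ (K + 1) * (1 / 2) ^ j := fun j => by
    -- The weight `2 ^ j` balances the two terms: against the decay `4⁻ʲ` both integrate to a
    -- multiple of `2⁻ʲ`.
    have hpt : ∀ x, ‖A (j + 1) x - A j x‖ ≤
        2 ^ j * ‖A (j + 1) x - A j x‖ ^ 2 + (1 / 2) ^ j := fun x => by
      set t := ‖A (j + 1) x - A j x‖
      have e : (2 : ℝ) ^ j * (1 / 2) ^ j = 1 := by rw [← mul_pow]; norm_num
      have h2 : (0 : ℝ) < 2 ^ j := by positivity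
      have h3 : 0 ≤ (2 ^ j * t - 1) ^ 2 + 2 ^ j * t := by positivity
      refine le_of_mul_le_mul_left ?_ h2
      have : (2 : ℝ) ^ j * (2 ^ j * t ^ 2 + (1 / 2) ^ j) = (2 ^ j * t) ^ 2 + 1 := by
        rw [mul_add, e]; ring
      rw [this]
      nlinarith
    calc ∫ x, ‖A (j + 1) x - A j x‖ ∂torusMeasure
        ≤ ∫ x, (2 ^ j * ‖A (j + 1) x - A j x‖ ^ 2 + (1 / 2) ^ j) ∂torusMeasure :=
          integral_mono (hint j) (((hint2 j).const_mul _).add (integrable_const _)) hpt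
      _ = 2 ^ j * ∫ x, ‖A (j + 1) x - A j x‖ ^ 2 ∂torusMeasure + (1 / 2) ^ j := by
          rw [integral_add ((hint2 j).const_mul _) (integrable_const _), integral_const_mul]
          simp
      _ ≤ 2 ^ j * (K * (1 / 4) ^ j) + (1 / 2) ^ j := by
          gcongr
          exact h j
      _ = (K + 1) * (1 / 2) ^ j := by
          have : (2 : ℝ) ^ j * (1 / 4) ^ j = (1 / 2) ^ j := by rw [← mul_pow]; norm_num
          rw [← this]; ring
  have hsum : Summable fun j => ∫ x, ‖A (j + 1) x - A j x‖ ∂torusMeasure :=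
    Summable.of_nonneg_of_le (fun j => integral_nonneg fun x => norm_nonneg _) hl1
      ((summable_geometric_of_lt_one (by norm_num) (by norm_num)).mul_left _)
  have hfin : ∫⁻ x, ∑' j, ENNReal.ofReal ‖A (j + 1) x - A j x‖ ∂torusMeasure ≠ ∞ := by
    rw [lintegral_tsum fun j => (hm j).ennreal_ofReal.aemeasurable]
    simp_rw [← fun j => ofReal_integral_eq_lintegral_ofReal (hint j)
      (Eventually.of_forall fun x => norm_nonneg (A (j + 1) x - A j x))]
    exact hsum.tsum_ofReal_ne_top
  filter_upwards [ae_lt_top' (AEMeasurable.tsum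
    fun j => (hm j).ennreal_ofReal.aemeasurable) hfin] with x hx
  have hs : Summable fun j => ‖A (j + 1) x - A j x‖ := by
    have := ENNReal.summable_toReal hx.ne
    simpa using this
  refine cauchySeq_tendsto_of_complete (cauchySeq_of_summable_dist ?_)
  refine hs.congr fun j => ?_
  rw [dist_comm, dist_eq_norm]

/-- A strictly positive, essentially bounded, lower semicontinuous function on the torus is the
squared modulus of a bounded function with spectrum in `C`. -/
theorem exists_bounded_sq_norm_eq {S C : Set (Fin 2 → ℤ)} {v : Fin 2 → ℤ}
    (hS : ∀ m ∈ S, ∀ n ∈ S, m + n ∈ S) (h0 : (0 : Fin 2 → ℤ) ∉ S)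
    (hv : ∀ n : Fin 2 → ℤ, ∃ N₀ : ℕ, ∀ N ≥ N₀, n + N • v ∈ S)
    (hC : ∀ n ∉ C, ∀ m ∈ S, n - m ∉ C) (h0C : (0 : Fin 2 → ℤ) ∈ C)
    {f : Torus2 → ℝ} (hf_pos : ∀ x, 0 < f x)
    (hf_bdd : ∃ M : ℝ, ∀ᵐ x ∂torusMeasure, f x ≤ M) (hf_lsc : LowerSemicontinuous f) :
    ∃ A : Torus2 → ℂ, Measurable A ∧ (∀ᵐ x ∂torusMeasure, ‖A x‖ ^ 2 = f x) ∧
      ∀ n ∉ C, mFourierCoeff A n = 0 := by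
  obtain ⟨M, hM⟩ := hf_bdd
  let F : Torus2 → ℝ := fun x => Real.log (f x) / 2
  have hFf : ∀ x, Real.exp (2 * F x) = f x := fun x => by
    simp only [F]
    rw [mul_div_cancel₀ _ two_ne_zero, Real.exp_log (hf_pos x)]
  have hF : LowerSemicontinuous F := fun x y hy => by
    have h1 : Real.exp (2 * y) < f x := by
      rw [← hFf]; exact Real.exp_lt_exp.2 (by linarith)
    filter_upwards [hf_lsc x _ h1] with z hz
    rw [gt_iff_lt, ← hFf, Real.exp_lt_exp] at hz
    linarith
  obtain ⟨x₀, -, hx₀⟩ := LowerSemicontinuousOn.exists_isMinOn Set.univ_nonempty isCompact_univ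
    (hF.lowerSemicontinuousOn Set.univ)
  -- Subtracting `1` makes the starting constant lie strictly below `F`, as `IsPartialFactor`
  -- requires.
  set c := F x₀ - 1 with hc
  have hcF : ∀ x, c < F x := fun x => by linarith [show F x₀ ≤ F x from hx₀ (Set.mem_univ x)]
  have hFM : ∀ᵐ x ∂torusMeasure, Real.exp (2 * F x) ≤ M := by
    filter_upwards [hM] with x hx
    rwa [hFf]
  have hM0 : 0 ≤ M := by
    obtain ⟨x, hx⟩ := hM.exists
    exact (hf_pos x).le.trans hx
  have hinit : IsPartialFactor C F c (fun _ => (Real.exp c : ℂ)) (fun _ => c) := by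
    refine ⟨measurable_const, continuous_const, Eventually.of_forall fun x => ?_, hcF,
      fun _ => le_rfl, fun n hn => ?_⟩
    · rw [Complex.norm_real, Real.norm_of_nonneg (Real.exp_pos _).le]
    · rw [mFourierCoeff_eq, integral_mul_const, integral_mFourier_eq_zero, zero_mul]
      rw [neg_ne_zero]
      rintro rfl
      exact hn h0C
  let T := {s : (Torus2 → ℂ) × (Torus2 → ℝ) // IsPartialFactor C F c s.1 s.2}
  have hstep : ∀ (s : T) (j : ℕ), ∃ s' : T,
      ∫ x, (Real.exp (2 * F x) - Real.exp (2 * s'.1.2 x)) ∂torusMeasure ≤ (1 / 4) ^ j ∧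
      ∫ x, ‖s'.1.1 x - s.1.1 x‖ ^ 2 ∂torusMeasure ≤ M * Real.exp (-2 * c) *
        ∫ x, (Real.exp (2 * F x) - Real.exp (2 * s.1.2 x)) ∂torusMeasure := fun s j => by
    obtain ⟨A', g', h1, h2, h3⟩ := s.2.exists_next hS h0 hv hC hF hFM
      (ε := (1 / 4) ^ j) (by positivity)
    exact ⟨⟨(A', g'), h1⟩, h2, h3⟩
  choose next hnext1 hnext2 using hstep
  -- The sequence starts after one step from the constant, so the deficit bound already holds at `j
  -- = 0`.
  let s : ℕ → T := fun j => Nat.rec (next ⟨(_, _), hinit⟩ 0) (fun j t => next t (j + 1)) j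
  have hs1 : ∀ j, ∫ x, (Real.exp (2 * F x) - Real.exp (2 * (s j).1.2 x)) ∂torusMeasure ≤
      (1 / 4) ^ j := fun j => by
    cases j with
    | zero => exact hnext1 _ _
    | succ j => exact hnext1 _ _
  have hs2 : ∀ j, ∫ x, ‖(s (j + 1)).1.1 x - (s j).1.1 x‖ ^ 2 ∂torusMeasure ≤
      M * Real.exp (-2 * c) * (1 / 4) ^ j := fun j =>
    (hnext2 (s j) (j + 1)).trans (mul_le_mul_of_nonneg_left (hs1 j) (by positivity))
  have hsq : ∀ j, ∀ᵐ x ∂torusMeasure,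
      ‖(s j).1.1 x‖ ^ 2 = Real.exp (2 * (s j).1.2 x) := fun j => by
    filter_upwards [(s j).2.norm_eq] with x hx
    rw [hx, ← Real.exp_nat_mul]
    norm_num
  have hle : ∀ j x, Real.exp (2 * (s j).1.2 x) ≤ f x := fun j x => by
    rw [← hFf]; exact Real.exp_le_exp.2 (by linarith [(s j).2.lt x])
  have hbd : ∀ j, ∀ᵐ x ∂torusMeasure, ‖(s j).1.1 x‖ ≤ M + 1 := fun j => by
    filter_upwards [hsq j, hM] with x h1 h2
    nlinarith [sq_nonneg (‖(s j).1.1 x‖ - 1), hle j x]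
  obtain ⟨A, hA, hlim⟩ := measurable_limit_of_tendsto_metrizable_ae
    (fun j => (s j).2.measurable.aemeasurable)
    (ae_exists_tendsto_of_integral_norm_sub_sq_le (fun j => (s j).2.measurable) hbd hs2)
  refine ⟨A, hA, ?_, fun n hn => ?_⟩
  · have hlimsq : ∀ᵐ x ∂torusMeasure,
        Tendsto (fun j => ‖(s j).1.1 x‖ ^ 2) atTop (𝓝 (‖A x‖ ^ 2)) := by
      filter_upwards [hlim] with x hx
      exact hx.norm.pow 2
    have hall : ∀ᵐ x ∂torusMeasure, ∀ j, ‖(s j).1.1 x‖ ^ 2 = Real.exp (2 * (s j).1.2 x) :=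
      ae_all_iff.2 hsq
    have hAf : ∀ᵐ x ∂torusMeasure, ‖A x‖ ^ 2 ≤ f x := by
      filter_upwards [hlimsq, hall] with x hx hx'
      exact le_of_tendsto hx (Eventually.of_forall fun j => (hx' j).trans_le (hle j x))
    have hfm : Measurable f := hf_lsc.measurable
    have h1 : Tendsto (fun j => ∫ x, (f x - ‖(s j).1.1 x‖ ^ 2) ∂torusMeasure) atTop
        (𝓝 (∫ x, (f x - ‖A x‖ ^ 2) ∂torusMeasure)) := by
      refine tendsto_integral_of_norm_bounded M (fun j =>
        (hfm.sub ((s j).2.measurable.norm.pow_const 2)).aestronglyMeasurable) (fun j => ?_) ?_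
      · filter_upwards [hsq j, hM] with x hx hx'
        have := hle j x
        rw [← hx] at this
        rw [Real.norm_of_nonneg (sub_nonneg.2 this)]
        linarith [sq_nonneg ‖(s j).1.1 x‖]
      · filter_upwards [hlimsq] with x hx
        exact hx.const_sub _
    -- The integrand is nonnegative almost everywhere and the deficits tend to `0`; this forces
    -- equality almost everywhere.
    have h2 : ∫ x, (f x - ‖A x‖ ^ 2) ∂torusMeasure ≤ 0 := by
      refine le_of_tendsto_of_tendsto' h1 (tendsto_pow_atTop_nhds_zero_of_lt_one
        (r := (1 / 4 : ℝ)) (by norm_num) (by norm_num)) fun j => ?_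
      refine le_trans (le_of_eq (integral_congr_ae ?_)) (hs1 j)
      filter_upwards [hsq j] with x hx
      rw [hx, hFf]
    have hnn : 0 ≤ᵐ[torusMeasure] fun x => f x - ‖A x‖ ^ 2 := by
      filter_upwards [hAf] with x hx
      exact sub_nonneg.2 hx
    have hint : Integrable (fun x => f x - ‖A x‖ ^ 2) torusMeasure := by
      refine Integrable.of_bound (hfm.sub (hA.norm.pow_const 2)).aestronglyMeasurable M ?_
      filter_upwards [hAf, hM] with x hx hx'
      rw [Real.norm_of_nonneg (sub_nonneg.2 hx)]
      linarith [sq_nonneg ‖A x‖]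
    filter_upwards [(integral_eq_zero_iff_of_nonneg_ae hnn hint).1
      (le_antisymm h2 (integral_nonneg_of_ae hnn))] with x hx
    exact (sub_eq_zero.1 hx).symm
  · have h1 : Tendsto (fun j => ∫ x, mFourier (-n) x * (s j).1.1 x ∂torusMeasure) atTop
        (𝓝 (∫ x, mFourier (-n) x * A x ∂torusMeasure)) := by
      refine tendsto_integral_of_norm_bounded (M + 1) (fun j =>
        ((mFourier (-n)).continuous.measurable.mul (s j).2.measurable).aestronglyMeasurable)
        (fun j => ?_) ?_
      · filter_upwards [hbd j] with x hx
        rwa [norm_mul, norm_mFourier_apply, one_mul]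
      · filter_upwards [hlim] with x hx
        exact hx.const_mul _
    rw [mFourierCoeff_eq]
    exact tendsto_nhds_unique h1 (tendsto_const_nhds.congr fun j =>
      ((s j).2.coeff_eq_zero n hn).symm)

/-! ### Determinants and convex lattice polygons -/

theorem toPlane_add (k l : Fin 2 → ℤ) : toPlane (k + l) = toPlane k + toPlane l := by
  ext i; simp [toPlane]

theorem toPlane_sub (k l : Fin 2 → ℤ) : toPlane (k - l) = toPlane k - toPlane l := by
  ext i; simp [toPlane]

theorem toPlane_nsmul (N : ℕ) (k : Fin 2 → ℤ) : toPlane (N • k) = (N : ℝ) • toPlane k := by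
  ext i; simp [toPlane]

theorem toPlane_injective : Function.Injective toPlane := fun k l h => by
  ext i; simpa [toPlane] using congrFun h i

theorem planeDet_smul_eq (x y z : Fin 2 → ℝ) :
    planeDet x y • z = planeDet z y • x + planeDet x z • y := by
  ext i
  fin_cases i <;> simp [planeDet] <;> ring

theorem exists_eq_smul_add_smul {x y : Fin 2 → ℝ} (h : planeDet x y ≠ 0) (z : Fin 2 → ℝ) :
    z = (planeDet z y / planeDet x y) • x + (planeDet x z / planeDet x y) • y := by
  rw [div_eq_inv_mul, div_eq_inv_mul, mul_smul, mul_smul, ← smul_add, ← planeDet_smul_eq,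
    smul_smul, inv_mul_cancel₀ h, one_smul]

namespace ConvexLatticePolygon

variable {m : ℕ} (P : ConvexLatticePolygon m)

theorem one_ne_zero (P : ConvexLatticePolygon m) : (1 : ZMod m) ≠ 0 := fun h => by
  have h1 := (ZMod.natCast_eq_zero_iff 1 m).1 (by simpa using h)
  have := Nat.le_of_dvd one_pos h1
  have := P.three_le
  omega

theorem two_ne_zero (P : ConvexLatticePolygon m) : (2 : ZMod m) ≠ 0 := fun h => by
  have h1 := (ZMod.natCast_eq_zero_iff 2 m).1 (by simpa using h)
  have := Nat.le_of_dvd two_pos h1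
  have := P.three_le
  omega

/-- The number whose sign tells on which side of its `i`-th side the polygon lies. -/
def orient (i : ZMod m) : ℝ := planeDet (P.side i) (toPlane (P.vertex (i + 2) - P.vertex i))

theorem orient_eq (i : ZMod m) : P.orient i = planeDet (P.side i) (P.side (i + 1)) := by
  have h : i + 1 + 1 = i + 2 := by ring
  simp only [orient, side, toPlane_sub, h, planeDet, Pi.sub_apply]
  ring

/-- Convexity at side `i + 1`, tested on vertex `i`: the resulting determinant is that of two
consecutive sides, which is `P.orient i`. -/
theorem orient_mul_succ_pos (i : ZMod m) : 0 < P.orient i * P.orient (i + 1) := by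
  have h1 : i ≠ i + 1 := fun h => P.one_ne_zero (by simpa using h)
  have h2 : i ≠ i + 1 + 1 := fun h => P.two_ne_zero (by
    rw [add_assoc, one_add_one_eq_two] at h; simpa using h)
  have h := P.convex (i + 1) i h1 h2
  change 0 < _ * P.orient (i + 1) at h
  convert h using 2
  rw [orient_eq]
  simp only [side, toPlane_sub, planeDet, Pi.sub_apply]
  ring

theorem orient_ne_zero (i : ZMod m) : P.orient i ≠ 0 :=
  left_ne_zero_of_mul (P.orient_mul_succ_pos i).ne'

theorem exists_eq_add_natCast (P : ConvexLatticePolygon m) (i j : ZMod m) :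
    ∃ t < m, j = i + (t : ZMod m) := by
  have : NeZero m := ⟨by have := P.three_le; omega⟩
  exact ⟨(j - i).val, ZMod.val_lt _, by rw [ZMod.natCast_zmod_val]; ring⟩

theorem orient_mul_pos (i j : ZMod m) : 0 < P.orient i * P.orient j := by
  obtain ⟨t, -, rfl⟩ := P.exists_eq_add_natCast i j
  induction t with
  | zero => simpa using mul_self_pos.2 (P.orient_ne_zero i)
  | succ t ih =>
    have h := mul_pos ih (P.orient_mul_succ_pos (i + t))
    rw [Nat.cast_succ, ← add_assoc]
    have h2 := mul_self_pos.2 (P.orient_ne_zero (i + t))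
    refine pos_of_mul_pos_left (b := P.orient (i + t) * P.orient (i + t)) ?_ h2.le
    convert h using 1
    ring

/-- All orientations share one sign, so a single reference index can replace the one belonging to
the side. -/
theorem mem_halfPlane₀_iff (i j : ZMod m) (x : Fin 2 → ℝ) :
    x ∈ P.halfPlane₀ i ↔ 0 ≤ planeDet (P.side i) x * P.orient j := by
  change 0 ≤ planeDet (P.side i) x * P.orient i ↔ _
  have h := P.orient_mul_pos i j
  have hi := mul_self_pos.2 (P.orient_ne_zero i)
  have hj := mul_self_pos.2 (P.orient_ne_zero j)
  constructor <;> intro hx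
  · refine nonneg_of_mul_nonneg_left (b := P.orient i * P.orient i) ?_ hi
    convert mul_nonneg hx h.le using 1
    ring
  · refine nonneg_of_mul_nonneg_left (b := P.orient j * P.orient j) ?_ hj
    convert mul_nonneg hx h.le using 1
    ring

theorem vertex_mem_halfPlane (i j : ZMod m) : toPlane (P.vertex j) ∈ P.halfPlane i := by
  change 0 ≤ planeDet (P.side i) (toPlane (P.vertex j) - toPlane (P.vertex i)) * P.orient i
  rcases eq_or_ne j i with rfl | h1
  · simp [planeDet]
  rcases eq_or_ne j (i + 1) with rfl | h2
  · refine le_of_eq ?_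
    simp only [side, toPlane_sub, planeDet, Pi.sub_apply]
    ring
  · rw [← toPlane_sub]
    exact (P.convex i j h1 h2).le

theorem planeDet_vertexHalfCone (p : ZMod m) :
    planeDet (toPlane (P.vertex (p - 1) - P.vertex p)) (toPlane (P.vertex (p + 1) - P.vertex p)) =
      -P.orient (p - 1) := by
  rw [orient_eq]
  simp only [side, toPlane_sub, sub_add_cancel, planeDet, Pi.sub_apply]
  ring

/-- By Cramer's rule, the coordinates of `x - A_p` along the two sides at `A_p` are positive
multiples of the forms defining the two half-planes. -/
theorem sub_mem_vertexHalfCone {p : ZMod m} {x : Fin 2 → ℝ} (h : x ∈ P.halfPlane p)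
    (h' : x ∈ P.halfPlane (p - 1)) : x - toPlane (P.vertex p) ∈ P.vertexHalfCone p := by
  have hne : planeDet (toPlane (P.vertex (p - 1) - P.vertex p))
      (toPlane (P.vertex (p + 1) - P.vertex p)) ≠ 0 := by
    rw [planeDet_vertexHalfCone]; exact neg_ne_zero.2 (P.orient_ne_zero _)
  have h1 := (P.mem_halfPlane₀_iff p (p - 1) _).1 h
  have h2 := (P.mem_halfPlane₀_iff (p - 1) (p - 1) _).1 h'
  have ho := mul_self_pos.2 (P.orient_ne_zero (p - 1))
  refine ⟨_, _, ?_, ?_, exists_eq_smul_add_smul hne _⟩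
  · rw [planeDet_vertexHalfCone, ← mul_div_mul_right _ _ (P.orient_ne_zero (p - 1)), neg_mul,
      div_neg, ← neg_div]
    refine div_nonneg ?_ ho.le
    refine h1.trans_eq ?_
    simp only [side, toPlane_sub, planeDet, Pi.sub_apply]
    ring
  · rw [planeDet_vertexHalfCone, ← mul_div_mul_right _ _ (P.orient_ne_zero (p - 1)), neg_mul,
      div_neg, ← neg_div]
    refine div_nonneg ?_ ho.le
    refine h2.trans_eq ?_
    simp only [side, toPlane_sub, sub_add_cancel, planeDet, Pi.sub_apply]
    ring

theorem convex_halfPlane (i : ZMod m) : Convex ℝ (P.halfPlane i) := by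
  intro x hx y hy a b ha hb hab
  change 0 ≤ planeDet (P.side i) (_ - _) * P.orient i
  have hx' : 0 ≤ planeDet (P.side i) (x - toPlane (P.vertex i)) * P.orient i := hx
  have hy' : 0 ≤ planeDet (P.side i) (y - toPlane (P.vertex i)) * P.orient i := hy
  refine (add_nonneg (mul_nonneg ha hx') (mul_nonneg hb hy')).trans_eq ?_
  obtain rfl : b = 1 - a := by linarith
  simp only [planeDet, Pi.sub_apply, Pi.add_apply, Pi.smul_apply, smul_eq_mul]
  ring

/-- A point in every half-plane but outside the hull would be separated from it by a form `φ`. At a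
vertex maximizing `φ` the point lies in the vertex cone, along whose generators `φ` does not
increase: a contradiction. -/
theorem region_eq : P.region = ⋂ i, P.halfPlane i := by
  have : NeZero m := ⟨by have := P.three_le; omega⟩
  refine Set.Subset.antisymm (Set.subset_iInter fun i => convexHull_min ?_ (P.convex_halfPlane i))
    fun x hx => ?_
  · rintro _ ⟨j, rfl⟩
    exact P.vertex_mem_halfPlane i j
  · by_contra hxr
    have hcl : IsClosed P.region := (Set.finite_range _).isClosed_convexHull ℝ
    obtain ⟨φ, u, hφ, hu⟩ := geometric_hahn_banach_closed_point (convex_convexHull ℝ _) hcl hxr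
    obtain ⟨p, hp⟩ := Finite.exists_max fun i => φ (toPlane (P.vertex i))
    have hv : ∀ i, φ (toPlane (P.vertex i)) < φ x := fun i =>
      (hφ _ (subset_convexHull ℝ _ ⟨i, rfl⟩)).trans hu
    rw [Set.mem_iInter] at hx
    obtain ⟨a, b, ha, hb, hab⟩ := P.sub_mem_vertexHalfCone (hx p) (hx (p - 1))
    have h := congrArg φ hab
    simp only [toPlane_sub, map_add, map_smul, map_sub, smul_eq_mul] at h
    nlinarith [hp (p - 1), hp (p + 1), hv p,
      mul_nonneg ha (sub_nonneg.2 (hp (p - 1))), mul_nonneg hb (sub_nonneg.2 (hp (p + 1)))]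

theorem vertex_injective : Function.Injective P.vertex := by
  intro i j h
  by_contra hij
  by_cases h2 : j = i + 1
  · have h3 : P.side i = 0 := by
      rw [side, ← h2, h, sub_self]; ext; simp [toPlane]
    exact P.orient_ne_zero i (by simp [orient, h3, planeDet])
  · have h3 := P.convex i j (Ne.symm hij) h2
    rw [h, sub_self] at h3
    simp [planeDet, toPlane] at h3

/-- The whole polygon lies in the cone at `A_p`, whose two generators have positive image under `φ`;
a strict local minimum is thus global and unique. -/
theorem lt_of_isLocalMin (φ : (Fin 2 → ℝ) →ₗ[ℝ] ℝ) {p j : ZMod m} (hj : j ≠ p)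
    (h₁ : φ (toPlane (P.vertex p)) < φ (toPlane (P.vertex (p - 1))))
    (h₂ : φ (toPlane (P.vertex p)) < φ (toPlane (P.vertex (p + 1)))) :
    φ (toPlane (P.vertex p)) < φ (toPlane (P.vertex j)) := by
  obtain ⟨a, b, ha, hb, hab⟩ := P.sub_mem_vertexHalfCone (P.vertex_mem_halfPlane p j)
    (P.vertex_mem_halfPlane (p - 1) j)
  have h := congrArg φ hab
  simp only [toPlane_sub, map_add, map_smul, map_sub, smul_eq_mul] at h
  have h3 := mul_nonneg ha (sub_pos.2 h₁).le
  have h4 := mul_nonneg hb (sub_pos.2 h₂).le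
  rcases ha.eq_or_lt with rfl | ha'
  · rcases hb.eq_or_lt with rfl | hb'
    · simp only [zero_smul, add_zero] at hab
      exact absurd (P.vertex_injective (toPlane_injective (sub_eq_zero.1 hab))) hj
    · linarith [mul_pos hb' (sub_pos.2 h₂)]
  · linarith [mul_pos ha' (sub_pos.2 h₁)]

/-- A linear form that is constant along no side increases along one block of consecutive sides and
decreases along the complementary block. -/
theorem exists_cyclicPartition (φ : (Fin 2 → ℝ) →ₗ[ℝ] ℝ) (hφ : ∀ i, φ (P.side i) ≠ 0) :
    ∃ I : CyclicPartition m 2, (∀ k ∈ I.block 0, 0 < φ (P.side k)) ∧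
      ∀ k ∈ I.block 1, φ (P.side k) < 0 := by
  have : NeZero m := ⟨by have := P.three_le; omega⟩
  obtain ⟨s, hs⟩ := Finite.exists_min fun i => φ (toPlane (P.vertex i))
  let h : ℕ → ℝ := fun t => φ (toPlane (P.vertex (s + t)))
  have hside : ∀ t : ℕ, φ (P.side (s + t)) = h (t + 1) - h t := fun t => by
    simp only [side, toPlane_sub, map_sub, h, Nat.cast_succ, add_assoc]
  have hne : ∀ t, h t ≠ h (t + 1) := fun t e => hφ (s + t) (by rw [hside, e, sub_self])
  have hm : h m = h 0 := by simp [h]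
  have hmin : ∀ t, h 0 ≤ h t := fun t => by simpa [h] using hs (s + t)
  have hex : ∃ t, h (t + 1) < h t := by
    by_contra! hcon
    have hmono : Monotone h := monotone_nat_of_le_succ hcon
    have h1 := (hmono (Nat.zero_le 1)).lt_of_ne (hne 0)
    have h2 := hmono (show 1 ≤ m by have := P.three_le; omega)
    linarith
  classical
  -- Starting from a global minimum, `c` is the first descent; it ends the first block.
  set c := Nat.find hex with hc
  have hcdown : h (c + 1) < h c := Nat.find_spec hex
  have hup : ∀ t < c, h t < h (t + 1) := fun t ht =>
    (not_lt.1 (Nat.find_min hex ht)).lt_of_ne (hne t)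
  have hc0 : 0 < c := by
    rcases Nat.eq_zero_or_pos c with h0 | h0
    · rw [h0] at hcdown
      exact absurd hcdown (not_lt.2 (hmin 1))
    · exact h0
  have hcm : c < m := by
    by_contra! hcon
    have h1 : ∀ t ≤ m, 0 < t → h 0 < h t := fun t => by
      induction t with
      | zero => intro _ h; exact absurd h (lt_irrefl _)
      | succ t _ => intro ht _; exact (hmin t).trans_lt (hup t (by omega))
    exact (h1 m le_rfl (by have := P.three_le; omega)).ne hm.symm
  have hdown : ∀ t, c ≤ t → t < m → h (t + 1) < h t := fun t hct => by
    induction t, hct using Nat.le_induction with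
    | base => exact fun _ => hcdown
    | succ t hct ih =>
      intro htm
      have ih' := ih (by omega)
      by_contra! hcon
      have hlt := hcon.lt_of_ne (hne (t + 1))
      have hsne : s ≠ s + ((t + 1 : ℕ) : ZMod m) := fun e => by
        have h1 : ((t + 1 : ℕ) : ZMod m) = 0 := by simpa using e
        have h2 := Nat.le_of_dvd (Nat.succ_pos t) ((ZMod.natCast_eq_zero_iff _ _).1 h1)
        omega
      -- An ascent after a descent would create a strict local minimum at a vertex other than `s`,
      -- lying strictly below the global minimum.
      refine absurd (P.lt_of_isLocalMin φ hsne ?_ ?_) (not_lt.2 (hs _))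
      · rwa [show s + ((t + 1 : ℕ) : ZMod m) - 1 = s + t by push_cast; ring]
      · rwa [show s + ((t + 1 : ℕ) : ZMod m) + 1 = s + ((t + 1 + 1 : ℕ) : ZMod m) by
          push_cast; ring]
  refine ⟨⟨s, ![0, c, m], ?_, rfl, rfl⟩, ?_, ?_⟩
  · rw [Fin.strictMono_iff_lt_succ]
    intro i
    fin_cases i
    · exact hc0
    · exact hcm
  · rintro k ⟨t, -, ht, rfl⟩
    change φ (P.side (s + t)) > 0
    rw [hside]
    exact sub_pos.2 (hup t ht)
  · rintro k ⟨t, ht, ht', rfl⟩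
    change φ (P.side (s + t)) < 0
    rw [hside]
    exact sub_neg.2 (hdown t ht ht')

theorem mem_block_or (P : ConvexLatticePolygon m) (I : CyclicPartition m 2) (k : ZMod m) :
    k ∈ I.block 0 ∨ k ∈ I.block 1 := by
  obtain ⟨t, ht, rfl⟩ := P.exists_eq_add_natCast I.start k
  by_cases h : t < I.cut 1
  · exact Or.inl ⟨t, by show I.cut 0 ≤ t; rw [I.cut_zero]; exact Nat.zero_le t, h, rfl⟩
  · exact Or.inr ⟨t, not_lt.1 h, ht.trans_eq I.cut_last.symm, rfl⟩

theorem latticePoints_eq (I : CyclicPartition m 2) :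
    P.latticePoints = I.posRegion P 0 ∩ I.posRegion P 1 := by
  ext k
  simp only [latticePoints, region_eq, trace, CyclicPartition.posRegion,
    CyclicPartition.negRegion, Set.mem_ofPred_eq, Set.mem_inter_iff, Set.mem_compl_iff,
    Set.mem_iUnion, Set.mem_iInter, not_exists, not_not]
  refine ⟨fun h => ⟨fun i _ => h i, fun i _ => h i⟩, fun h i => ?_⟩
  rcases P.mem_block_or I i with hi | hi
  · exact h.1 i hi
  · exact h.2 i hi

end ConvexLatticePolygon

/-! ### A lattice cone avoiding the directions of the sides -/

/-- A nonzero affine function of `t` eventually keeps a constant nonzero sign. -/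
theorem exists_nat_forall_ge_mul_pos {x y : ℝ} (h : x ≠ 0 ∨ y ≠ 0) :
    ∃ T : ℕ, ∀ t ≥ T, 0 < (x + (t : ℝ) * y) * (x + ((t + 1 : ℕ) : ℝ) * y) := by
  rcases eq_or_ne y 0 with rfl | hy
  · exact ⟨0, fun t _ => by simpa using mul_self_pos.2 (h.resolve_right (by simp))⟩
  · obtain ⟨T, hT⟩ := exists_nat_gt (-(x / y))
    refine ⟨T, fun t ht => ?_⟩
    have h1 : (T : ℝ) ≤ t := by exact_mod_cast ht
    have h2 : 0 < x / y + t := by linarith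
    have h3 : 0 < y * y * ((x / y + t) * (x / y + t + 1)) := by
      have := mul_self_pos.2 hy
      positivity
    convert h3 using 1
    push_cast
    field_simp
    ring

namespace ConvexLatticePolygon

variable {m : ℕ} (P : ConvexLatticePolygon m)

/-- At every vertex there is a lattice cone inside the cone of the vertex whose half-cone meets, away
from the origin, no line parallel to a side. -/
theorem exists_lattice_cone (a : ZMod m) :
    ∃ e₁ e₂ : Fin 2 → ℤ, planeDet (toPlane e₁) (toPlane e₂) ≠ 0 ∧
      doubleCone (toPlane e₁) (toPlane e₂) ⊆ P.vertexCone a ∧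
      halfCone (toPlane e₁) (toPlane e₂) ⊆ P.vertexHalfCone a ∧
      ∀ i, 0 < planeDet (P.side i) (toPlane e₁) * planeDet (P.side i) (toPlane e₂) := by
  have : NeZero m := ⟨by have := P.three_le; omega⟩
  set u₁ := P.vertex (a - 1) - P.vertex a with hu₁
  set u₂ := P.vertex (a + 1) - P.vertex a with hu₂
  have hdet : planeDet (toPlane u₁) (toPlane u₂) ≠ 0 := by
    rw [P.planeDet_vertexHalfCone a]; exact neg_ne_zero.2 (P.orient_ne_zero _)
  have hT : ∀ i, ∃ T : ℕ, ∀ t ≥ T,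
      0 < (planeDet (P.side i) (toPlane u₁) + (t : ℝ) * planeDet (P.side i) (toPlane u₂)) *
        (planeDet (P.side i) (toPlane u₁) +
          ((t + 1 : ℕ) : ℝ) * planeDet (P.side i) (toPlane u₂)) := fun i => by
    refine exists_nat_forall_ge_mul_pos ?_
    by_contra! hcon
    have h1 := exists_eq_smul_add_smul hdet (P.side i)
    have h2 : planeDet (toPlane u₁) (P.side i) = -planeDet (P.side i) (toPlane u₁) := by
      simp only [planeDet]; ring
    rw [h2, hcon.1, hcon.2] at h1
    simp only [neg_zero, zero_div, zero_smul, add_zero] at h1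
    exact P.orient_ne_zero i (by simp [orient, h1, planeDet])
  choose T hT using hT
  obtain ⟨t, ht⟩ : ∃ t, ∀ i, T i ≤ t :=
    ⟨Finset.univ.sup T, fun i => Finset.le_sup (Finset.mem_univ i)⟩
  have hcoe : ∀ t : ℕ, toPlane (u₁ + t • u₂) = toPlane u₁ + (t : ℝ) • toPlane u₂ := fun t => by
    rw [toPlane_add, toPlane_nsmul]
  have hcomb : ∀ x y : ℝ, x • toPlane (u₁ + t • u₂) + y • toPlane (u₁ + (t + 1) • u₂) =
      (x + y) • toPlane u₁ + (x * t + y * (t + 1)) • toPlane u₂ := fun x y => by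
    rw [hcoe, hcoe]
    push_cast
    module
  have hpos : halfCone (toPlane (u₁ + t • u₂)) (toPlane (u₁ + (t + 1) • u₂)) ⊆
      P.vertexHalfCone a := by
    rintro _ ⟨x, y, hx, hy, rfl⟩
    exact ⟨x + y, x * t + y * (t + 1), by positivity, by positivity, hcomb x y⟩
  -- For large `t` these two directions are close to that of `u₂`, with no side direction between
  -- them; their determinant is still that of `u₁, u₂`.
  refine ⟨u₁ + t • u₂, u₁ + (t + 1) • u₂, ?_, ?_, hpos, fun i => ?_⟩
  · convert hdet using 1
    rw [hcoe, hcoe]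
    simp only [planeDet, Pi.add_apply, Pi.smul_apply, smul_eq_mul, Nat.cast_succ]
    ring
  · refine Set.union_subset_union hpos ?_
    rintro _ ⟨x, y, hx, hy, rfl⟩
    have ht0 : (0 : ℝ) ≤ t := Nat.cast_nonneg t
    exact ⟨x + y, x * t + y * (t + 1), by linarith, by
      nlinarith [mul_nonneg (neg_nonneg.2 hx) ht0,
        mul_nonneg (neg_nonneg.2 hy) (by linarith : (0 : ℝ) ≤ t + 1)], hcomb x y⟩
  · convert hT i t (ht i) using 1
    rw [hcoe, hcoe]
    simp only [planeDet, Pi.add_apply, Pi.smul_apply, smul_eq_mul]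
    ring

end ConvexLatticePolygon

/-! ### The semigroup of lattice points of an open cone -/

/-- The lattice points of the open half-cone spanned by `e₁` and `e₂`. -/
def openConePoints (e₁ e₂ : Fin 2 → ℝ) : Set (Fin 2 → ℤ) :=
  {k | ∃ a b : ℝ, 0 < a ∧ 0 < b ∧ toPlane k = a • e₁ + b • e₂}

section Cone

variable {e₁ e₂ : Fin 2 → ℤ}

theorem linearIndependent_of_planeDet_ne_zero {e₁ e₂ : Fin 2 → ℝ} (h : planeDet e₁ e₂ ≠ 0) :
    LinearIndependent ℝ ![e₁, e₂] := by
  rw [LinearIndependent.pair_iff]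
  intro s t hst
  have h0 := congrFun hst 0
  have h1 := congrFun hst 1
  simp only [Pi.add_apply, Pi.smul_apply, smul_eq_mul, Pi.zero_apply] at h0 h1
  constructor
  · refine (mul_eq_zero.1 (?_ : s * planeDet e₁ e₂ = 0)).resolve_right h
    simp only [planeDet]
    linear_combination e₂ 1 * h0 - e₂ 0 * h1
  · refine (mul_eq_zero.1 (?_ : t * planeDet e₁ e₂ = 0)).resolve_right h
    simp only [planeDet]
    linear_combination e₁ 0 * h1 - e₁ 1 * h0

theorem add_mem_openConePoints {e₁ e₂ : Fin 2 → ℝ} :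
    ∀ m ∈ openConePoints e₁ e₂, ∀ n ∈ openConePoints e₁ e₂, m + n ∈ openConePoints e₁ e₂ := by
  rintro m ⟨a, b, ha, hb, h⟩ n ⟨a', b', ha', hb', h'⟩
  refine ⟨a + a', b + b', add_pos ha ha', add_pos hb hb', ?_⟩
  rw [toPlane_add, h, h']
  module

theorem zero_notMem_openConePoints {e₁ e₂ : Fin 2 → ℝ} (h : planeDet e₁ e₂ ≠ 0) :
    (0 : Fin 2 → ℤ) ∉ openConePoints e₁ e₂ := by
  rintro ⟨a, b, ha, -, hab⟩
  have h0 : toPlane 0 = 0 := by ext; simp [toPlane]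
  rw [h0] at hab
  exact ha.ne' (LinearIndependent.pair_iff.1 (linearIndependent_of_planeDet_ne_zero h) a b
    hab.symm).1

theorem exists_add_nsmul_mem_openConePoints (h : planeDet (toPlane e₁) (toPlane e₂) ≠ 0)
    (n : Fin 2 → ℤ) :
    ∃ N₀ : ℕ, ∀ N ≥ N₀, n + N • (e₁ + e₂) ∈ openConePoints (toPlane e₁) (toPlane e₂) := by
  have hn := exists_eq_smul_add_smul h (toPlane n)
  set x := planeDet (toPlane n) (toPlane e₂) / planeDet (toPlane e₁) (toPlane e₂)
  set y := planeDet (toPlane e₁) (toPlane n) / planeDet (toPlane e₁) (toPlane e₂)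
  obtain ⟨N₀, hN₀⟩ := exists_nat_gt (max (-x) (-y))
  refine ⟨N₀, fun N hN => ⟨x + N, y + N, ?_, ?_, ?_⟩⟩
  · have : (N₀ : ℝ) ≤ N := by exact_mod_cast hN
    linarith [(le_max_left (-x) (-y)).trans_lt hN₀]
  · have : (N₀ : ℝ) ≤ N := by exact_mod_cast hN
    linarith [(le_max_right (-x) (-y)).trans_lt hN₀]
  · rw [toPlane_add, toPlane_nsmul, toPlane_add, hn]
    module

theorem sub_notMem_trace_halfCone {e₁ e₂ : Fin 2 → ℝ} :
    ∀ n ∉ trace (halfCone e₁ e₂), ∀ m ∈ openConePoints e₁ e₂,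
      n - m ∉ trace (halfCone e₁ e₂) := by
  rintro n hn m ⟨a, b, ha, hb, h⟩ ⟨a', b', ha', hb', h'⟩
  refine hn ⟨a + a', b + b', by positivity, by positivity, ?_⟩
  rw [toPlane_sub, h, sub_eq_iff_eq_add] at h'
  rw [h']
  module

theorem zero_mem_trace_halfCone {e₁ e₂ : Fin 2 → ℝ} :
    (0 : Fin 2 → ℤ) ∈ trace (halfCone e₁ e₂) :=
  ⟨0, 0, le_rfl, le_rfl, by ext; simp [toPlane]⟩

end Cone

/-! ### Factorizations in `L^∞` and the conclusion -/

theorem mFourierCoeff_congr_ae {g h : Torus2 → ℂ} (hgh : g =ᵐ[torusMeasure] h) (n : Fin 2 → ℤ) :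
    mFourierCoeff g n = mFourierCoeff h n := by
  rw [mFourierCoeff_eq, mFourierCoeff_eq]
  refine integral_congr_ae ?_
  filter_upwards [hgh] with x hx
  rw [hx]

theorem mFourierCoeff_star (α : Linfty) (n : Fin 2 → ℤ) :
    mFourierCoeff ((star α : Linfty) : Torus2 → ℂ) n =
      starRingEnd ℂ (mFourierCoeff (α : Torus2 → ℂ) (-n)) := by
  rw [mFourierCoeff_eq, mFourierCoeff_eq, ← integral_conj, neg_neg]
  refine integral_congr_ae ?_
  filter_upwards [Lp.coeFn_star α] with x hx
  rw [hx, map_mul, ← mFourier_neg, Pi.star_apply, starRingEnd_apply]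

theorem spec_star_subset {e₁ e₂ : Fin 2 → ℝ} {α : Linfty}
    (h : spec α ⊆ trace (halfCone e₁ e₂)) :
    spec (star α : Linfty) ⊆ trace (oppositeHalfCone e₁ e₂) := by
  intro n hn
  have h1 : -n ∈ spec α := fun h0 => hn (by rw [mFourierCoeff_star, h0, map_zero])
  obtain ⟨a, b, ha, hb, hab⟩ := h h1
  refine ⟨-a, -b, neg_nonpos.2 ha, neg_nonpos.2 hb, ?_⟩
  rw [neg_smul, neg_smul, ← neg_add, ← hab]
  ext i
  simp [toPlane]

/-- A unimodular constant changes neither the modulus nor the spectrum. If `A` and `i A` were both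
real almost everywhere, `A` would vanish almost everywhere, against `f > 0`; so one of them is not
its own conjugate. -/
theorem exists_isConeFactorization_ne_star {f : Torus2 → ℝ} (hf_pos : ∀ x, 0 < f x)
    (hf_bdd : ∃ M : ℝ, ∀ᵐ x ∂torusMeasure, f x ≤ M) (hf_lsc : LowerSemicontinuous f)
    {e₁ e₂ : Fin 2 → ℤ} (he : planeDet (toPlane e₁) (toPlane e₂) ≠ 0) :
    ∃ α : Linfty, IsConeFactorization f (toPlane e₁) (toPlane e₂) α ∧ α ≠ star α := by
  obtain ⟨A, hA, hAf, hspec⟩ := exists_bounded_sq_norm_eq add_mem_openConePoints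
    (zero_notMem_openConePoints he) (exists_add_nsmul_mem_openConePoints he)
    sub_notMem_trace_halfCone zero_mem_trace_halfCone hf_pos hf_bdd hf_lsc
  have key : ∀ c : ℂ, ‖c‖ = 1 → ∃ α : Linfty, α =ᵐ[torusMeasure] (fun x => c * A x) ∧
      IsConeFactorization f (toPlane e₁) (toPlane e₂) α := fun c hc => by
    obtain ⟨M, hM⟩ := hf_bdd
    have hmem : MemLp (fun x => c * A x) ∞ torusMeasure := by
      refine memLp_top_of_bound (hA.const_mul c).aestronglyMeasurable (M + 1) ?_
      filter_upwards [hAf, hM] with x h1 h2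
      rw [norm_mul, hc, one_mul]
      nlinarith [sq_nonneg (‖A x‖ - 1)]
    refine ⟨hmem.toLp _, hmem.coeFn_toLp, ?_, fun n hn => ?_⟩
    · filter_upwards [hmem.coeFn_toLp, Lp.coeFn_star (hmem.toLp _), hAf] with x h1 h2 h3
      rw [h2, Pi.star_apply, h1, ← h3]
      change _ = _ * (starRingEnd ℂ) _
      rw [Complex.mul_conj, Complex.normSq_eq_norm_sq, norm_mul, hc, one_mul]
    · by_contra hnC
      refine hn ?_
      rw [mFourierCoeff_congr_ae hmem.coeFn_toLp, mFourierCoeff_eq]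
      simp_rw [mul_left_comm _ c]
      rw [integral_const_mul, ← mFourierCoeff_eq, hspec n hnC, mul_zero]
  obtain ⟨α, hαA, hα⟩ := key 1 norm_one
  obtain ⟨β, hβA, hβ⟩ := key Complex.I Complex.norm_I
  by_cases hne : α ≠ star α
  · exact ⟨α, hα, hne⟩
  refine ⟨β, hβ, fun hβs => ?_⟩
  rw [not_not] at hne
  have hα' := Lp.coeFn_star α
  have hβ' := Lp.coeFn_star β
  rw [← hne] at hα'
  rw [← hβs] at hβ'
  obtain ⟨x, ⟨h1, h2⟩, ⟨h3, h4⟩, h5⟩ := ((hαA.and hβA).and ((hα'.and hβ').and hAf)).exists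
  beta_reduce at h1 h2
  rw [Pi.star_apply, h1, one_mul] at h3
  rw [Pi.star_apply, h2, star_mul, ← h3] at h4
  have h6 : A x = 0 := by
    have hI : star Complex.I = -Complex.I := Complex.conj_I
    rw [hI] at h4
    have h7 : 2 * Complex.I * A x = 0 := by linear_combination h4
    simpa using h7
  rw [h6] at h5
  have := hf_pos x
  simp at h5
  linarith

/-- By semicontinuity and compactness, `f` attains a positive minimum, which bounds `‖α‖` away from
zero. -/
theorem memLp_inv_of_isConeFactorization {f : Torus2 → ℝ} (hf_pos : ∀ x, 0 < f x)
    (hf_lsc : LowerSemicontinuous f) {α : Linfty}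
    (h : ∀ᵐ x ∂torusMeasure, (f x : ℂ) = α x * (star α : Linfty) x) :
    MemLp (fun x => (α x)⁻¹) ∞ torusMeasure := by
  obtain ⟨x₀, -, hx₀⟩ := LowerSemicontinuousOn.exists_isMinOn Set.univ_nonempty isCompact_univ
    (hf_lsc.lowerSemicontinuousOn Set.univ)
  refine memLp_top_of_bound (Lp.aestronglyMeasurable α).aemeasurable.inv.aestronglyMeasurable
    ((f x₀)⁻¹ + 1) ?_
  filter_upwards [h, Lp.coeFn_star α] with x h1 h2
  rw [h2, Pi.star_apply] at h1
  change _ = _ * (starRingEnd ℂ) _ at h1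
  rw [Complex.mul_conj, Complex.normSq_eq_norm_sq, Complex.ofReal_inj] at h1
  have h3 : f x₀ ≤ ‖α x‖ ^ 2 := h1 ▸ hx₀ (Set.mem_univ x)
  have h4 : (‖α x‖⁻¹) ^ 2 ≤ (f x₀)⁻¹ := by
    rw [inv_pow]
    exact inv_anti₀ (hf_pos x₀) h3
  rw [norm_inv]
  nlinarith [sq_nonneg (‖α x‖⁻¹ - 1)]

theorem mainTheorem6 (f : Torus2 → ℝ) (hf_pos : ∀ x, 0 < f x)
    (hf_bdd : ∃ M : ℝ, ∀ᵐ x ∂torusMeasure, f x ≤ M) (hf_lsc : LowerSemicontinuous f)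
    {m : ℕ} (P : ConvexLatticePolygon m) (a : ZMod m) :
    ∃ (e₁ e₂ : Fin 2 → ℝ) (α : Linfty) (G : ZMod m → Linfty) (I : CyclicPartition m 2),
      IsAssociatedFactorization f P a e₁ e₂ α G ∧
      IsMinimalFactorization I G α (star α) ∧
      (∀ j, spec ((![α, star α] : Fin 2 → Linfty) j) ⊆ I.posRegion₀ P j) ∧
      P.latticePoints = I.posRegion P 0 ∩ I.posRegion P 1 := by
  obtain ⟨e₁, e₂, he, hcone, hhalf, hside⟩ := P.exists_lattice_cone a
  obtain ⟨α, hα, hne⟩ := exists_isConeFactorization_ne_star hf_pos hf_bdd hf_lsc he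
  -- The sum `e₁ + e₂` is an interior direction of the half-cone; each side's determinants with `e₁`
  -- and `e₂` share a sign, so testing the sum decides for the whole half-cone. The factor `P.orient
  -- 0` accounts for the numbering direction.
  let φ : (Fin 2 → ℝ) →ₗ[ℝ] ℝ :=
    { toFun := fun x => planeDet x (toPlane e₁ + toPlane e₂) * P.orient 0
      map_add' := fun x y => by simp only [planeDet, Pi.add_apply]; ring
      map_smul' := fun c x => by
        simp only [planeDet, Pi.add_apply, Pi.smul_apply, smul_eq_mul, RingHom.id_apply]; ring }
  have hφ : ∀ i, φ (P.side i) = planeDet (P.side i) (toPlane e₁) * P.orient 0 +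
      planeDet (P.side i) (toPlane e₂) * P.orient 0 := fun i => by
    change planeDet (P.side i) (toPlane e₁ + toPlane e₂) * P.orient 0 = _
    simp only [planeDet, Pi.add_apply]
    ring
  have hprod : ∀ i, 0 < (planeDet (P.side i) (toPlane e₁) * P.orient 0) *
      (planeDet (P.side i) (toPlane e₂) * P.orient 0) := fun i => by
    rw [mul_mul_mul_comm]
    exact mul_pos (hside i) (mul_self_pos.2 (P.orient_ne_zero 0))
  obtain ⟨I, hI0, hI1⟩ := P.exists_cyclicPartition φ fun i => by
    rw [hφ]
    rcases mul_pos_iff.1 (hprod i) with h | h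
    · exact (add_pos h.1 h.2).ne'
    · exact (add_neg h.1 h.2).ne
  have hpos : ∀ i, 0 < φ (P.side i) →
      halfCone (toPlane e₁) (toPlane e₂) ⊆ P.halfPlane₀ i := fun i hi => by
    rw [hφ] at hi
    obtain ⟨h1, h2⟩ := (mul_pos_iff.1 (hprod i)).resolve_right (fun h => by linarith [h.1, h.2])
    rintro _ ⟨x, y, hx, hy, rfl⟩
    rw [P.mem_halfPlane₀_iff i 0]
    refine (add_nonneg (mul_nonneg hx h1.le) (mul_nonneg hy h2.le)).trans_eq ?_
    simp only [planeDet, Pi.add_apply, Pi.smul_apply, smul_eq_mul]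
    ring
  have hneg : ∀ i, φ (P.side i) < 0 →
      oppositeHalfCone (toPlane e₁) (toPlane e₂) ⊆ P.halfPlane₀ i := fun i hi => by
    rw [hφ] at hi
    obtain ⟨h1, h2⟩ := (mul_pos_iff.1 (hprod i)).resolve_left (fun h => by linarith [h.1, h.2])
    rintro _ ⟨x, y, hx, hy, rfl⟩
    rw [P.mem_halfPlane₀_iff i 0]
    refine (add_nonneg (mul_nonneg_of_nonpos_of_nonpos hx h1.le)
      (mul_nonneg_of_nonpos_of_nonpos hy h2.le)).trans_eq ?_
    simp only [planeDet, Pi.add_apply, Pi.smul_apply, smul_eq_mul]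
    ring
  have hαs : ∀ᵐ x ∂torusMeasure,
      (f x : ℂ) = (star α : Linfty) x * (star (star α) : Linfty) x := by
    rw [star_star]
    filter_upwards [hα.mul_star] with x hx
    rw [hx, mul_comm]
  have hspec : spec α ⊆ trace (halfCone (toPlane e₁) (toPlane e₂)) := hα.spec_subset
  have hspec' := spec_star_subset hspec
  classical
  let G : ZMod m → Linfty := fun i => if 0 < φ (P.side i) then α else star α
  have hG : ∀ i, (0 < φ (P.side i) ∧ G i = α) ∨ (φ (P.side i) < 0 ∧ G i = star α) := fun i => by
    rcases P.mem_block_or I i with h | h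
    · exact Or.inl ⟨hI0 i h, if_pos (hI0 i h)⟩
    · exact Or.inr ⟨hI1 i h, if_neg (hI1 i h).not_gt⟩
  refine ⟨toPlane e₁, toPlane e₂, α, G, I, ⟨linearIndependent_of_planeDet_ne_zero he, hcone,
    hhalf, hα, fun i => ?_, fun i => ?_, fun i => ?_, fun i => ?_⟩, ⟨le_rfl, ?_, ?_⟩, ?_,
    P.latticePoints_eq I⟩
  · exact (hG i).imp (fun h => ⟨hpos i h.1, h.2⟩) fun h => ⟨hneg i h.1, h.2⟩
  · rcases hG i with h | h <;> rw [h.2]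
    · exact hα.mul_star
    · exact hαs
  · rcases hG i with h | h <;> rw [h.2]
    · exact memLp_inv_of_isConeFactorization hf_pos hf_lsc hα.mul_star
    · exact memLp_inv_of_isConeFactorization hf_pos hf_lsc hαs
  · rcases hG i with h | h <;> rw [h.2]
    · exact fun n hn => hpos i h.1 (hspec hn)
    · exact fun n hn => hneg i h.1 (hspec' hn)
  · rw [Fin.forall_fin_two]
    exact ⟨fun k hk => if_pos (hI0 k hk), fun k hk => if_neg (hI1 k hk).not_gt⟩
  · rw [Fin.forall_fin_two]
    exact ⟨hne, hne.symm⟩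
  · rw [Fin.forall_fin_two]
    exact ⟨fun n hn => Set.mem_iInter₂.2 fun k hk => hpos k (hI0 k hk) (hspec hn),
      fun n hn => Set.mem_iInter₂.2 fun k hk => hneg k (hI1 k hk) (hspec' hn)⟩
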